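/- Let $N\ge 1$, let $A_1$ be a qubit and let $A_2,\dots,A_N$ have arbitrary finite dimensions $d_2,\dots,d_N$; let $1<q\le 2$. For a bipartite pure state $|\phi\rangle_{AB}$ with $\rho_A=\mathrm{Tr}_B|\phi\rangle\langle\phi|$ put $$C(|\phi\rangle_{AB})=\sqrt{2\,[1-\mathrm{Tr}(\rho_A^2)]},\qquad \mathscr{C}_q(|\phi\rangle_{AB})=[1-\mathrm{Tr}(\rho_A^q)]^{1/q},$$ and extend both to mixed states by the convex roof, $E(\rho_{AB})=\min\sum_i p_iE(|\phi_i\rangle_{AB})$ over all pure-state decompositions $\rho_{AB}=\sum_i p_i|\phi_i\rangle\langle\phi_i|$. For $E=C$ or $E=\mathscr{C}_q$ call $E^2$ monogamous on a state $\rho=\rho_{A_1A_2\cdots A_N}$ if $$E^2(\rho_{A_1|A_2\cdots A_N})\ \ge\ \sum_{j=2}^{N}E^2(\rho_{A_1A_j}),$$ where $\rho_{A_1A_j}$ is the reduced state of $A_1$ and $A_j$. Let $$h_q(t)=\Big[1-\Big(\tfrac{1+\sqrt{1-t}}{2}\Big)^q-\Big(\tfrac{1-\sqrt{1-t}}{2}\Big)^q\Big]^{1/q}.$$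 Then in the $2\otimes d_2\otimes\cdots\otimes d_N$ system: (1) for every state $\rho$, pure or mixed, if $C^2$ is monogamous on $\rho$, then $\mathscr{C}_q^2$ is monogamous on $\rho$; (2) if $C^2$ is monogamous on all pure states of the system, then $\mathscr{C}_q^2$ is monogamous on all states of the system, pure or mixed; (3) (whether or not $C^2$ is monogamous on it) $\mathscr{C}_q^2$ is monogamous on every pure state $|\phi\rangle$ of the system that satisfies $h_q^2\big(C^2(|\phi\rangle_{A_1|A_2\cdots A_N})\big)\ge\sum_{j=2}^{N}h_q^2\big(C^2(\rho_{A_1A_j})\big)$; (4) if $\mathscr{C}_q^2$ is monogamous on all pure states of the system, then it is monogamous on all states of the system. -/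

import Mathlib

open scoped ComplexOrder

noncomputable section

namespace Entanglement

/-- A density matrix (a quantum state) with index set `ι`:
positive semidefinite with unit trace. -/
def IsState {ι : Type*} [Fintype ι] (ρ : Matrix ι ι ℂ) : Prop :=
  ρ.PosSemidef ∧ ρ.trace = 1

/-- A normalized state vector. -/
def IsUnitVec {ι : Type*} [Fintype ι] (ψ : ι → ℂ) : Prop :=
  ∑ i, ‖ψ i‖ ^ 2 = 1

/-- The projector `|ψ⟩⟨ψ|`. -/
def proj {ι : Type*} (ψ : ι → ℂ) : Matrix ι ι ℂ :=
  Matrix.vecMulVec ψ (star ψ)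

/-- The coefficient matrix of a bipartite vector `ψ = ∑ ψ (a, b) |a⟩|b⟩`. -/
def coeffMatrix {α β : Type*} (ψ : α × β → ℂ) : Matrix α β ℂ :=
  Matrix.of fun a b => ψ (a, b)

/-- The reduced density matrix `ρ_A = Tr_B |ψ⟩⟨ψ|` of a bipartite vector, with entries
`∑ b, ψ (a, b) * conj (ψ (a', b))`. -/
def reducedA {α β : Type*} [Fintype β] (ψ : α × β → ℂ) : Matrix α α ℂ :=
  coeffMatrix ψ * (coeffMatrix ψ).conjTranspose

theorem reducedA_isHermitian {α β : Type*} [Fintype β] (ψ : α × β → ℂ) :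
    (reducedA ψ).IsHermitian :=
  Matrix.isHermitian_mul_conjTranspose_self _

/-- `Tr (ρ_A ^ q)` for real `q`: the sum of the `q`-th powers of the eigenvalues of `ρ_A`. -/
def trPowA {α β : Type*} [Fintype α] [DecidableEq α] [Fintype β] (q : ℝ) (ψ : α × β → ℂ) : ℝ :=
  ∑ i, (reducedA_isHermitian ψ).eigenvalues i ^ q

/-- Concurrence of a bipartite pure state, `C(ψ) = √(2 (1 - Tr ρ_A²))`. -/
def concurrencePure {α β : Type*} [Fintype α] [Fintype β] (ψ : α × β → ℂ) : ℝ :=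
  √(2 * (1 - ((reducedA ψ * reducedA ψ).trace).re))

/-- `G_q`-concurrence of a bipartite pure state, `(1 - Tr ρ_A ^ q) ^ (1 / q)`. -/
def gqPure {α β : Type*} [Fintype α] [DecidableEq α] [Fintype β] (q : ℝ) (ψ : α × β → ℂ) : ℝ :=
  (1 - trPowA q ψ) ^ (1 / q)

/-- `{p i, φ i}` is a (finite) pure-state decomposition of `ρ`. -/
structure IsDecomposition {ι : Type*} [Fintype ι] (ρ : Matrix ι ι ℂ) {m : ℕ}
    (p : Fin m → ℝ) (φ : Fin m → ι → ℂ) : Prop where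
  nonneg : ∀ i, 0 ≤ p i
  sum_eq_one : ∑ i, p i = 1
  unit : ∀ i, IsUnitVec (φ i)
  sum_eq : ρ = ∑ i, (p i : ℂ) • proj (φ i)

/-- The values `∑ p i * E (φ i)` over all pure-state decompositions of `ρ`. -/
def roofValues {ι : Type*} [Fintype ι] (E : (ι → ℂ) → ℝ) (ρ : Matrix ι ι ℂ) : Set ℝ :=
  {x | ∃ (m : ℕ) (p : Fin m → ℝ) (φ : Fin m → ι → ℂ),
    IsDecomposition ρ p φ ∧ x = ∑ i, p i * E (φ i)}

/-- The convex roof of `E` at `ρ`. -/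
def convexRoof {ι : Type*} [Fintype ι] (E : (ι → ℂ) → ℝ) (ρ : Matrix ι ι ℂ) : ℝ :=
  sInf (roofValues E ρ)

/-- Concurrence of a bipartite (mixed) state `ρ_AB`. -/
def concurrence {α β : Type*} [Fintype α] [Fintype β] (ρ : Matrix (α × β) (α × β) ℂ) : ℝ :=
  convexRoof concurrencePure ρ

/-- `G_q`-concurrence of a bipartite (mixed) state `ρ_AB`. -/
def gqConcurrence {α β : Type*} [Fintype α] [DecidableEq α] [Fintype β] (q : ℝ)
    (ρ : Matrix (α × β) (α × β) ℂ) : ℝ :=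
  convexRoof (gqPure q) ρ

/-- Basis labels of the parties other than the first: the `j`-th of them has dimension `d j`. -/
abbrev Rest {n : ℕ} (d : Fin n → ℕ) : Type := (j : Fin n) → Fin (d j)

/-- Basis labels of the whole system: a qubit `A₁` and the other parties, split as
`A₁ | A₂ ⋯ A_N`. -/
abbrev Sys {n : ℕ} (d : Fin n → ℕ) : Type := Fin 2 × Rest d

/-- The two-party reduced state of the first party and party `j`: all parties other than
these two are traced out. -/
def pairState {n : ℕ} {d : Fin n → ℕ} (ρ : Matrix (Sys d) (Sys d) ℂ) (j : Fin n) :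
    Matrix (Fin 2 × Fin (d j)) (Fin 2 × Fin (d j)) ℂ :=
  Matrix.of fun x y =>
    ∑ f : Rest d with f j = x.2, ρ (x.1, f) (y.1, Function.update f j y.2)

/-- The state `ρ` satisfies the monogamy relation of the squared concurrence. -/
def SCMonogamous {n : ℕ} {d : Fin n → ℕ} (ρ : Matrix (Sys d) (Sys d) ℂ) : Prop :=
  ∑ j, concurrence (pairState ρ j) ^ 2 ≤ concurrence ρ ^ 2

/-- The state `ρ` satisfies the monogamy relation of the squared `G_q`-concurrence. -/
def SGqCMonogamous {n : ℕ} {d : Fin n → ℕ} (q : ℝ) (ρ : Matrix (Sys d) (Sys d) ℂ) : Prop :=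
  ∑ j, gqConcurrence q (pairState ρ j) ^ 2 ≤ gqConcurrence q ρ ^ 2

/-- The function `h_q` on `[0, 1]`, by which `𝒞_q = h_q (C²)` holds on pure states whose first
party is a qubit. -/
def hq (q t : ℝ) : ℝ :=
  (1 - ((1 + √(1 - t)) / 2) ^ q - ((1 - √(1 - t)) / 2) ^ q) ^ (1 / q)

end Entanglement

end

/-!
The squared `G_q`-concurrence of a qubit `A` with arbitrarily many parties of arbitrary dimensions
is monogamous on *every* state, for `1 < q ≤ 2`, whatever the behaviour of the squared
concurrence. The four claims are instances of this fact, `sGqCMonogamous_of_nonempty`, which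
applies to all matrices that have a pure-state decomposition, hence to all states.

*Reduction to a pure state of `A`, `B`, `C`.* Parties are split off one at a time, so three systems
suffice. The inequality passes from pure to mixed states because `√(Y ^ 2 + Z ^ 2)` is a norm of
`(Y, Z)` and the convex roof is convex (`gqConcurrence_sq_add_le`).

*The pure case* (`exists_roofValues_sq_add_le`). In a basis of the qubit that diagonalizes its
reduced state, a pure state is a pair of `B × C` matrices `U, V`, orthogonal and with
`a = ‖U‖ ^ 2 ≥ b = ‖V‖ ^ 2`, and its `G_q`-concurrence is `G(a, b)`, where
`G(x, y) ^ q = (x + y) ^ q - x ^ q - y ^ q` (`gqPair`). A measurement of `C` in a Parseval frame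
leaves pure states of `A` and `B` with components `u, v`, and `G` of the eigenvalues of such a
state is at most `G(‖u‖ ^ 2, ‖v - s u‖ ^ 2)` for every scalar `s`: the determinant is at most the
product of these arguments, and at a given product `G` grows as the eigenvalues come closer
(`gqPair_le_of_schur`). As `G` is superadditive (`sum_gqPair_le`), the average over the outcomes is
at most `G(a, y)`, where `y` is the total of the `‖v - s u‖ ^ 2`.

*The choice of the measurement.* If `U` is a positive diagonal matrix `Σ` and `V ≈ Σ K` with `K`
Hermitian, an eigenbasis of `K` turns this into `v ≈ s u` in each column, and `y = ‖V - Σ K‖ ^ 2`.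
For the measurement of `B` one approximates `V ≈ M Σ` instead. Solving the two least-squares
problems explicitly shows that, up to a common phase, the two errors add up to at most
`‖V‖ ^ 2 = b` (`exists_isHermitian_approx`); the singular value decomposition extends this to all
`U` (`exists_hasSchurFrame`).

*Conclusion.* `G(a, ·) ^ 2` is star-shaped on `[0, a]`, hence superadditive there
(`gqPair_sq_add_le`). This and the monotonicity used above are the same fact about
`((1 + z) ^ q - 1 - z ^ q) / z ^ (q / 2)`, which is increasing on `(0, 1]`
(`monotoneOn_powDefect_mul_rpow`) because `1 - z ^ q ≥ (1 - z) (1 + z) ^ (q - 1)` for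
`1 ≤ q ≤ 2`.
-/

noncomputable section

namespace Entanglement

open Matrix

/-! ### The two-eigenvalue functional -/

/-- The defect of additivity `(x + y) ^ q - x ^ q - y ^ q`. For the eigenvalues `x, y` of a qubit
state it equals `1 - Tr ρ ^ q`. -/
def powDefect (q x y : ℝ) : ℝ := (x + y) ^ q - x ^ q - y ^ q

/-- The homogeneous form of the `G_q`-concurrence as a function of the two eigenvalues of an
unnormalized qubit state. -/
def gqPair (q x y : ℝ) : ℝ := powDefect q x y ^ (1 / q)

lemma powDefect_comm (q x y : ℝ) : powDefect q x y = powDefect q y x := by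
  unfold powDefect; rw [add_comm x y]; ring

lemma powDefect_nonneg {q x y : ℝ} (hq : 1 ≤ q) (hx : 0 ≤ x) (hy : 0 ≤ y) :
    0 ≤ powDefect q x y := by
  have := Real.add_rpow_le_rpow_add hx hy hq
  unfold powDefect; linarith

lemma powDefect_zero_right {q : ℝ} (hq : 1 ≤ q) (x : ℝ) : powDefect q x 0 = 0 := by
  simp [powDefect, Real.zero_rpow (by linarith : q ≠ 0)]

lemma gqPair_nonneg {q x y : ℝ} (hq : 1 ≤ q) (hx : 0 ≤ x) (hy : 0 ≤ y) : 0 ≤ gqPair q x y :=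
  Real.rpow_nonneg (powDefect_nonneg hq hx hy) _

lemma gqPair_comm (q x y : ℝ) : gqPair q x y = gqPair q y x := by
  unfold gqPair; rw [powDefect_comm]

lemma gqPair_zero_right {q : ℝ} (hq : 1 ≤ q) (x : ℝ) : gqPair q x 0 = 0 := by
  rw [gqPair, powDefect_zero_right hq, Real.zero_rpow]; positivity

lemma powDefect_smul {q t x y : ℝ} (ht : 0 ≤ t) (hx : 0 ≤ x) (hy : 0 ≤ y) :
    powDefect q (t * x) (t * y) = t ^ q * powDefect q x y := by
  unfold powDefect
  rw [← mul_add, Real.mul_rpow ht (by positivity), Real.mul_rpow ht hx, Real.mul_rpow ht hy]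
  ring

lemma gqPair_smul {q t x y : ℝ} (hq : 1 ≤ q) (ht : 0 ≤ t) (hx : 0 ≤ x) (hy : 0 ≤ y) :
    gqPair q (t * x) (t * y) = t * gqPair q x y := by
  unfold gqPair
  rw [powDefect_smul ht hx hy, Real.mul_rpow (by positivity) (powDefect_nonneg hq hx hy),
    ← Real.rpow_mul ht, mul_one_div_cancel (by linarith), Real.rpow_one]

lemma one_sub_mul_rpow_le {q z : ℝ} (hq1 : 1 ≤ q) (hq2 : q ≤ 2) (hz : 0 ≤ z) (hz1 : z ≤ 1) :
    (1 - z) * (1 + z) ^ (q - 1) ≤ 1 - z ^ q := by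
  have h1 : (1 + z) ^ (q - 1) ≤ 1 + (q - 1) * z :=
    rpow_one_add_le_one_add_mul_self (by linarith) (by linarith) (by linarith)
  have h2 : z ^ q ≤ (2 - q) * z + (q - 1) * z ^ 2 := by
    have := Real.geom_mean_le_arith_mean2_weighted (by linarith : 0 ≤ 2 - q)
      (by linarith : 0 ≤ q - 1) hz (sq_nonneg z) (by ring)
    rwa [← Real.rpow_natCast z 2, ← Real.rpow_mul hz,
      ← Real.rpow_add_of_nonneg hz (by linarith) (by push_cast; linarith),
      show (2 - q + ((2 : ℕ) : ℝ) * (q - 1)) = q by push_cast; ring,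
      Real.rpow_natCast] at this
  nlinarith [mul_le_mul_of_nonneg_left h1 (by linarith : 0 ≤ 1 - z)]

/-- On a hyperbola `x * y = const`, the additivity defect is a monotone function of the
ratio of the two arguments; this holds precisely because `1 ≤ q ≤ 2`. -/
lemma monotoneOn_powDefect_mul_rpow {q : ℝ} (hq1 : 1 ≤ q) (hq2 : q ≤ 2) :
    MonotoneOn (fun z : ℝ => powDefect q 1 z * z ^ (-(q / 2))) (Set.Ioc 0 1) := by
  have hd : ∀ z : ℝ, 0 < z → HasDerivAt (fun z : ℝ => powDefect q 1 z * z ^ (-(q / 2)))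
      ((q * (1 + z) ^ (q - 1) - q * z ^ (q - 1)) * z ^ (-(q / 2)) +
        powDefect q 1 z * (-(q / 2) * z ^ (-(q / 2) - 1))) z := by
    intro z hz
    have h1 : HasDerivAt (fun z : ℝ => (1 + z) ^ q) (q * (1 + z) ^ (q - 1)) z := by
      have := ((hasDerivAt_id z).const_add 1).rpow_const (p := q) (Or.inr hq1)
      simpa using this
    have h2 : HasDerivAt (fun z : ℝ => z ^ q) (q * z ^ (q - 1)) z :=
      Real.hasDerivAt_rpow_const (Or.inr hq1)
    have h3 : HasDerivAt (fun z : ℝ => z ^ (-(q / 2))) (-(q / 2) * z ^ (-(q / 2) - 1)) z :=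
      Real.hasDerivAt_rpow_const (Or.inl hz.ne')
    have h4 : HasDerivAt (fun z : ℝ => powDefect q 1 z)
        (q * (1 + z) ^ (q - 1) - q * z ^ (q - 1)) z := by
      have := (h1.sub_const ((1 : ℝ) ^ q)).sub h2
      exact this
    exact h4.mul h3
  apply monotoneOn_of_deriv_nonneg (convex_Ioc 0 1)
  · intro z hz
    exact (hd z hz.1).continuousAt.continuousWithinAt
  · intro z hz
    rw [interior_Ioc] at hz
    exact (hd z hz.1).differentiableAt.differentiableWithinAt
  · intro z hz
    rw [interior_Ioc] at hz
    rw [(hd z hz.1).deriv]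
    have hz0 := hz.1
    have e1 : z ^ (-(q / 2)) = z * z ^ (-(q / 2) - 1) := by
      rw [Real.rpow_sub_one hz0.ne']; field_simp
    have e2 : z ^ q = z * z ^ (q - 1) := by
      rw [Real.rpow_sub_one hz0.ne']; field_simp
    have e3 : (1 + z) ^ q = (1 + z) * (1 + z) ^ (q - 1) := by
      rw [Real.rpow_sub_one (by linarith)]; field_simp
    have key := one_sub_mul_rpow_le hq1 hq2 hz0.le hz.2.le
    have e4 : (q * (1 + z) ^ (q - 1) - q * z ^ (q - 1)) * z ^ (-(q / 2)) +
        powDefect q 1 z * (-(q / 2) * z ^ (-(q / 2) - 1)) =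
        (q / 2) * z ^ (-(q / 2) - 1) * (1 - z ^ q - (1 - z) * (1 + z) ^ (q - 1)) := by
      unfold powDefect
      rw [e1, e3, e2, Real.one_rpow]; ring
    rw [e4]
    have := Real.rpow_pos_of_pos hz0 (-(q / 2) - 1)
    apply mul_nonneg (by positivity); linarith

lemma powDefect_eq_mul {q x y : ℝ} (hx : 0 < x) (hy : 0 < y) :
    powDefect q x y = (x * y) ^ (q / 2) * (powDefect q 1 (y / x) * (y / x) ^ (-(q / 2))) := by
  have h : powDefect q x y = x ^ q * powDefect q 1 (y / x) := by
    rw [← powDefect_smul hx.le zero_le_one (by positivity)]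
    congr 1 <;> field_simp
  rw [h, Real.mul_rpow hx.le hy.le, Real.div_rpow hy.le hx.le, Real.rpow_neg hy.le,
    Real.rpow_neg hx.le]
  have e : x ^ q = x ^ (q / 2) * x ^ (q / 2) := by rw [← Real.rpow_add hx]; ring_nf
  have hyp := Real.rpow_pos_of_pos hy (q / 2)
  rw [e]; field_simp

lemma powDefect_le_of_mul_eq_of_le {q x y x' y' : ℝ} (hq1 : 1 ≤ q) (hq2 : q ≤ 2)
    (hx' : 0 < x') (hy : 0 < y) (hy' : 0 < y') (hyx : y ≤ x) (hyx' : y' ≤ x')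
    (hmul : x * y = x' * y') (hadd : x' + y' ≤ x + y) :
    powDefect q x y ≤ powDefect q x' y' := by
  have hx : 0 < x := hy.trans_le hyx
  rw [powDefect_eq_mul hx hy, powDefect_eq_mul hx' hy', hmul]
  have hyy : y ≤ y' := by
    by_contra! h
    nlinarith [mul_nonneg (sub_nonneg.2 h.le) (sub_nonneg.2 hyx), mul_pos hx' hy']
  have hxx : x' ≤ x := by
    by_contra! h
    nlinarith
  refine mul_le_mul_of_nonneg_left ?_ (by positivity)
  apply monotoneOn_powDefect_mul_rpow hq1 hq2
  · exact ⟨by positivity, (div_le_one hx).2 hyx⟩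
  · exact ⟨by positivity, (div_le_one hx').2 hyx'⟩
  · gcongr

/-- At a fixed product, the additivity defect decreases when the sum increases. -/
lemma powDefect_le_of_mul_eq {q x y x' y' : ℝ} (hq1 : 1 ≤ q) (hq2 : q ≤ 2)
    (hx : 0 < x) (hy : 0 < y) (hx' : 0 < x') (hy' : 0 < y')
    (hmul : x * y = x' * y') (hadd : x' + y' ≤ x + y) :
    powDefect q x y ≤ powDefect q x' y' := by
  rcases le_total y x with h | h <;> rcases le_total y' x' with h' | h'
  · exact powDefect_le_of_mul_eq_of_le hq1 hq2 hx' hy hy' h h' hmul hadd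
  · rw [powDefect_comm q x' y']
    exact powDefect_le_of_mul_eq_of_le hq1 hq2 hy' hy hx' h h' (by linarith) (by linarith)
  · rw [powDefect_comm q x y]
    exact powDefect_le_of_mul_eq_of_le hq1 hq2 hx' hx hy' h h' (by linarith) (by linarith)
  · rw [powDefect_comm q x y, powDefect_comm q x' y']
    exact powDefect_le_of_mul_eq_of_le hq1 hq2 hy' hx hx' h h' (by linarith) (by linarith)

lemma powDefect_mono_right {q x y y' : ℝ} (hq : 1 ≤ q) (hx : 0 ≤ x) (hy : 0 ≤ y) (hyy : y ≤ y') :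
    powDefect q x y ≤ powDefect q x y' := by
  have hm : MonotoneOn (fun y : ℝ => (x + y) ^ q - y ^ q) (Set.Ici 0) := by
    have hd : ∀ z : ℝ, HasDerivAt (fun y : ℝ => (x + y) ^ q - y ^ q)
        (q * (x + z) ^ (q - 1) - q * z ^ (q - 1)) z := by
      intro z
      have h1 : HasDerivAt (fun z : ℝ => (x + z) ^ q) (q * (x + z) ^ (q - 1)) z := by
        have := ((hasDerivAt_id z).const_add x).rpow_const (p := q) (Or.inr hq)
        simpa using this
      exact h1.sub (Real.hasDerivAt_rpow_const (Or.inr hq))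
    apply monotoneOn_of_deriv_nonneg (convex_Ici 0)
    · exact fun z _ => (hd z).continuousAt.continuousWithinAt
    · exact fun z _ => (hd z).differentiableAt.differentiableWithinAt
    · intro z hz
      rw [interior_Ici] at hz
      rw [(hd z).deriv]
      have hz0 : 0 < z := hz
      have : z ^ (q - 1) ≤ (x + z) ^ (q - 1) :=
        Real.rpow_le_rpow hz0.le (by linarith) (by linarith)
      nlinarith
  have := hm (Set.mem_Ici.2 hy) (Set.mem_Ici.2 (hy.trans hyy)) hyy
  simp only at this
  unfold powDefect; linarith

lemma gqPair_mono_right {q x y y' : ℝ} (hq : 1 ≤ q) (hx : 0 ≤ x) (hy : 0 ≤ y) (hyy : y ≤ y') :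
    gqPair q x y ≤ gqPair q x y' :=
  Real.rpow_le_rpow (powDefect_nonneg hq hx hy) (powDefect_mono_right hq hx hy hyy)
    (by positivity)

/-- The `G_q`-concurrence of a qubit state `[[p, n], [n̄, r]]` with eigenvalues `x, y` is at most
that of `diag (p, s)`, as soon as `s` is at least the Schur complement `det / p`. -/
lemma gqPair_le_of_schur {q x y p r s : ℝ} (hq1 : 1 ≤ q) (hq2 : q ≤ 2) (hx : 0 ≤ x) (hy : 0 ≤ y)
    (hp : 0 ≤ p) (hs : 0 ≤ s) (hadd : x + y = p + r) (hr : x * y ≤ p * r)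
    (hs' : x * y ≤ p * s) : gqPair q x y ≤ gqPair q p s := by
  rcases hx.eq_or_lt with rfl | hx0
  · rw [gqPair_comm, gqPair_zero_right hq1]; exact gqPair_nonneg hq1 hp hs
  rcases hy.eq_or_lt with rfl | hy0
  · rw [gqPair_zero_right hq1]; exact gqPair_nonneg hq1 hp hs
  have hxy : 0 < x * y := mul_pos hx0 hy0
  have hp0 : 0 < p := by
    rcases hp.eq_or_lt with rfl | h
    · simp at hs'; linarith
    · exact h
  have h1 : x * y / p ≤ r := by rw [div_le_iff₀ hp0]; linarith
  have h2 : x * y / p ≤ s := by rw [div_le_iff₀ hp0]; linarith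
  have h3 : 0 < x * y / p := by positivity
  refine le_trans ?_ (gqPair_mono_right hq1 hp h3.le h2)
  refine Real.rpow_le_rpow (powDefect_nonneg hq1 hx hy) ?_ (by positivity)
  exact powDefect_le_of_mul_eq hq1 hq2 hx0 hy0 hp0 h3 (by field_simp) (by linarith)

lemma concaveOn_gqPair {q : ℝ} (hq : 1 ≤ q) :
    ConcaveOn ℝ (Set.Icc 0 1) (fun t : ℝ => gqPair q (1 - t) t) := by
  have h1 : ConcaveOn ℝ (Set.Icc (0 : ℝ) 1) (fun t : ℝ => powDefect q (1 - t) t) := by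
    have ha : ConvexOn ℝ (Set.Icc (0 : ℝ) 1) (fun t : ℝ => t ^ q) :=
      (convexOn_rpow hq).subset Set.Icc_subset_Ici_self (convex_Icc 0 1)
    have hb : ConvexOn ℝ (Set.Icc (0 : ℝ) 1) (fun t : ℝ => (1 - t) ^ q) := by
      refine ⟨convex_Icc 0 1, fun x hx y hy a b ha hb hab => ?_⟩
      have := (convexOn_rpow hq).2 (Set.mem_Ici.2 (by linarith [hx.2] : 0 ≤ 1 - x))
        (Set.mem_Ici.2 (by linarith [hy.2] : 0 ≤ 1 - y)) ha hb hab
      simp only [smul_eq_mul] at this ⊢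
      convert this using 2
      linear_combination (-1 : ℝ) * hab
    have := (ha.add hb).neg.add_const 1
    refine this.congr fun t _ => ?_
    simp [powDefect]; ring
  have h2 : ConcaveOn ℝ (Set.Ici (0 : ℝ)) (fun t : ℝ => t ^ (1 / q)) :=
    Real.concaveOn_rpow (by positivity) (by rw [div_le_one (by linarith)]; exact hq)
  refine ⟨convex_Icc 0 1, fun x hx y hy a b ha hb hab => ?_⟩
  have hx' : 0 ≤ powDefect q (1 - x) x := powDefect_nonneg hq (by linarith [hx.2]) hx.1
  have hy' : 0 ≤ powDefect q (1 - y) y := powDefect_nonneg hq (by linarith [hy.2]) hy.1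
  refine (h2.2 hx' hy' ha hb hab).trans ?_
  refine Real.rpow_le_rpow (by simp only [smul_eq_mul]; positivity) ?_ (by positivity)
  exact h1.2 hx hy ha hb hab

lemma gqPair_eq_smul {q x y : ℝ} (hq : 1 ≤ q) (hx : 0 ≤ x) (hy : 0 ≤ y) :
    gqPair q x y = (x + y) * gqPair q (1 - y / (x + y)) (y / (x + y)) := by
  rcases (add_nonneg hx hy).eq_or_lt with h | h
  · have h1 : y = 0 := by linarith
    rw [← h, h1, gqPair_zero_right hq]; simp
  · have h1 : 1 - y / (x + y) = x / (x + y) := by field_simp; ring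
    rw [h1, ← gqPair_smul hq h.le (by positivity) (by positivity)]
    congr 1 <;> field_simp

/-- `gqPair` is concave and homogeneous, hence superadditive. -/
lemma sum_gqPair_le {κ : Type*} [Fintype κ] {q : ℝ} (hq : 1 ≤ q) {x y : κ → ℝ}
    (hx : ∀ k, 0 ≤ x k) (hy : ∀ k, 0 ≤ y k) :
    ∑ k, gqPair q (x k) (y k) ≤ gqPair q (∑ k, x k) (∑ k, y k) := by
  have hX : 0 ≤ ∑ k, x k := Finset.sum_nonneg fun k _ => hx k
  have hY : 0 ≤ ∑ k, y k := Finset.sum_nonneg fun k _ => hy k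
  rcases (add_nonneg hX hY).eq_or_lt with h | h
  · have hX0 : ∑ k, x k = 0 := by linarith
    have hY0 : ∑ k, y k = 0 := by linarith
    rw [hX0, hY0, gqPair_zero_right hq]
    refine (Finset.sum_eq_zero fun k _ => ?_).le
    rw [(Finset.sum_eq_zero_iff_of_nonneg fun k _ => hy k).1 hY0 k (Finset.mem_univ k),
      gqPair_zero_right hq]
  set S := (∑ k, x k) + ∑ k, y k with hS
  have hsum : ∑ k, (x k + y k) / S = 1 := by
    rw [← Finset.sum_div, Finset.sum_add_distrib, ← hS, div_self h.ne']
  have hJ := (concaveOn_gqPair hq).le_map_sum (t := Finset.univ)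
    (w := fun k => (x k + y k) / S) (p := fun k => y k / (x k + y k))
    (fun k _ => div_nonneg (add_nonneg (hx k) (hy k)) h.le) hsum
    (fun k _ => ⟨div_nonneg (hy k) (add_nonneg (hx k) (hy k)),
      div_le_one_of_le₀ (by linarith [hx k]) (add_nonneg (hx k) (hy k))⟩)
  have e1 : ∑ k, ((x k + y k) / S) • (y k / (x k + y k)) = (∑ k, y k) / S := by
    rw [Finset.sum_div]
    refine Finset.sum_congr rfl fun k _ => ?_
    rcases (add_nonneg (hx k) (hy k)).eq_or_lt with h0 | h0
    · have : y k = 0 := by linarith [hx k, hy k]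
      simp [this]
    · simp only [smul_eq_mul]; field_simp
  rw [e1] at hJ
  rw [gqPair_eq_smul hq hX hY, ← hS]
  calc ∑ k, gqPair q (x k) (y k)
      = S * ∑ k, ((x k + y k) / S) • gqPair q (1 - y k / (x k + y k)) (y k / (x k + y k)) := by
        rw [Finset.mul_sum]
        refine Finset.sum_congr rfl fun k _ => ?_
        rw [gqPair_eq_smul hq (hx k) (hy k), smul_eq_mul]
        field_simp
    _ ≤ _ := mul_le_mul_of_nonneg_left hJ h.le

/-- The square of `gqPair` is star-shaped, hence superadditive, in the smaller argument. -/
lemma gqPair_sq_add_le {q a b y₁ y₂ : ℝ} (hq1 : 1 ≤ q) (hq2 : q ≤ 2) (hba : b ≤ a)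
    (h1 : 0 ≤ y₁) (h2 : 0 ≤ y₂) (h : y₁ + y₂ ≤ b) :
    gqPair q a y₁ ^ 2 + gqPair q a y₂ ^ 2 ≤ gqPair q a b ^ 2 := by
  rcases (h1.trans (by linarith : y₁ ≤ b)).eq_or_lt with hb | hb
  · have e1 : y₁ = 0 := by linarith
    have e2 : y₂ = 0 := by linarith
    rw [e1, e2, ← hb, gqPair_zero_right hq1]; simp
  have ha : 0 < a := hb.trans_le hba
  have key : ∀ y, 0 ≤ y → y ≤ b → gqPair q a y ^ 2 ≤ (y / b) * gqPair q a b ^ 2 := by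
    intro y hy hyb
    rcases hy.eq_or_lt with rfl | hy0
    · rw [gqPair_zero_right hq1]; simp
    set φ := fun z : ℝ => powDefect q 1 z * z ^ (-(q / 2)) with hφ
    have hφ0 : ∀ z, 0 ≤ z → 0 ≤ φ z := fun z hz =>
      mul_nonneg (powDefect_nonneg hq1 zero_le_one hz) (Real.rpow_nonneg hz _)
    have e : ∀ y, 0 < y → gqPair q a y ^ 2 = (a * y) * (φ (y / a) ^ (1 / q)) ^ 2 := by
      intro y hy
      rw [gqPair, powDefect_eq_mul ha hy,
        Real.mul_rpow (by positivity) (hφ0 _ (by positivity)), mul_pow]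
      congr 1
      rw [← Real.rpow_mul (by positivity), ← Real.rpow_natCast, ← Real.rpow_mul (by positivity)]
      have : q / 2 * (1 / q) * ((2 : ℕ) : ℝ) = 1 := by push_cast; field_simp
      rw [this, Real.rpow_one]
    rw [e y hy0, e b hb]
    have hm : φ (y / a) ≤ φ (b / a) :=
      monotoneOn_powDefect_mul_rpow hq1 hq2
        ⟨by positivity, (div_le_one ha).2 (hyb.trans hba)⟩
        ⟨by positivity, (div_le_one ha).2 hba⟩ (by gcongr)
    have hm' : φ (y / a) ^ (1 / q) ≤ φ (b / a) ^ (1 / q) :=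
      Real.rpow_le_rpow (hφ0 _ (by positivity)) hm (by positivity)
    have h0 : 0 ≤ φ (y / a) ^ (1 / q) := Real.rpow_nonneg (hφ0 _ (by positivity)) _
    have : y / b * (a * b * (φ (b / a) ^ (1 / q)) ^ 2) = a * y * (φ (b / a) ^ (1 / q)) ^ 2 := by
      field_simp
    rw [this]
    gcongr
  have k1 := key y₁ h1 (by linarith)
  have k2 := key y₂ h2 (by linarith)
  have : y₁ / b + y₂ / b ≤ 1 := by rw [← add_div, div_le_one hb]; exact h
  nlinarith [sq_nonneg (gqPair q a b)]

/-! ### Hermitian approximation of a matrix from both sides -/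

section Frobenius
variable {l m n : Type*} [Fintype l] [Fintype m] [Fintype n]

/-- The squared Frobenius norm. -/
def frobSq (X : Matrix m n ℂ) : ℝ := ∑ i, ∑ j, ‖X i j‖ ^ 2

lemma frobSq_nonneg (X : Matrix m n ℂ) : 0 ≤ frobSq X :=
  Finset.sum_nonneg fun _ _ => Finset.sum_nonneg fun _ _ => sq_nonneg _

lemma frobSq_zero : frobSq (0 : Matrix m n ℂ) = 0 := by simp [frobSq]

lemma frobSq_transpose (X : Matrix m n ℂ) : frobSq Xᵀ = frobSq X := Finset.sum_comm

lemma frobSq_conjTranspose (X : Matrix m n ℂ) : frobSq Xᴴ = frobSq X := by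
  unfold frobSq
  rw [Finset.sum_comm]
  simp

lemma ofReal_frobSq (X : Matrix m n ℂ) : (frobSq X : ℂ) = (Xᴴ * X).trace := by
  simp only [frobSq, Matrix.trace, Matrix.diag, Matrix.mul_apply, Matrix.conjTranspose_apply]
  rw [Finset.sum_comm]
  push_cast
  refine Finset.sum_congr rfl fun i _ => Finset.sum_congr rfl fun j _ => ?_
  rw [← Complex.conj_mul']; rfl

lemma frobSq_smul (c : ℂ) (X : Matrix m n ℂ) : frobSq (c • X) = ‖c‖ ^ 2 * frobSq X := by
  simp [frobSq, Finset.mul_sum, mul_pow]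

lemma frobSq_mul_of_mul_conjTranspose [DecidableEq m] (X : Matrix l m ℂ) {C : Matrix m n ℂ}
    (hC : C * Cᴴ = 1) : frobSq (X * C) = frobSq X := by
  have : (frobSq (X * C) : ℂ) = frobSq X := by
    rw [ofReal_frobSq, ofReal_frobSq, conjTranspose_mul, Matrix.mul_assoc, trace_mul_comm,
      Matrix.mul_assoc, Matrix.mul_assoc, hC, Matrix.mul_one]
  exact_mod_cast this

lemma frobSq_mul_of_conjTranspose_mul [DecidableEq n] {F : Matrix m n ℂ} (hF : Fᴴ * F = 1)
    (Y : Matrix n l ℂ) : frobSq (F * Y) = frobSq Y := by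
  rw [← frobSq_conjTranspose, conjTranspose_mul, frobSq_mul_of_mul_conjTranspose,
    frobSq_conjTranspose]
  rwa [conjTranspose_conjTranspose]

/-- Pythagoras for the range of an isometry `F`. -/
lemma frobSq_sub_mul [DecidableEq n] {F : Matrix m n ℂ} (hF : Fᴴ * F = 1) (X : Matrix m l ℂ)
    (Y : Matrix n l ℂ) :
    frobSq (X - F * Y) = frobSq X - frobSq (Fᴴ * X) + frobSq (Fᴴ * X - Y) := by
  have h : (Yᴴ * Fᴴ) * (F * Y) = Yᴴ * Y := by
    rw [Matrix.mul_assoc, ← Matrix.mul_assoc Fᴴ, hF, Matrix.one_mul]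
  have : (frobSq (X - F * Y) : ℂ) = frobSq X - frobSq (Fᴴ * X) + frobSq (Fᴴ * X - Y) := by
    simp only [ofReal_frobSq, conjTranspose_mul, conjTranspose_sub, Matrix.sub_mul,
      Matrix.mul_sub, trace_sub, h, conjTranspose_conjTranspose, Matrix.mul_assoc]
    ring
  exact_mod_cast this

lemma frobSq_conjTranspose_mul_le [DecidableEq n] {F : Matrix m n ℂ} (hF : Fᴴ * F = 1)
    (X : Matrix m l ℂ) : frobSq (Fᴴ * X) ≤ frobSq X := by
  have h := frobSq_sub_mul hF X (Fᴴ * X)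
  have h1 := frobSq_nonneg (X - F * (Fᴴ * X))
  rw [sub_self, frobSq_zero] at h
  linarith

lemma frobSq_mul_le [DecidableEq n] {E : Matrix m n ℂ} (hE : Eᴴ * E = 1)
    (X : Matrix l m ℂ) : frobSq (X * E) ≤ frobSq X := by
  have := frobSq_conjTranspose_mul_le hE Xᴴ
  rwa [← conjTranspose_mul, frobSq_conjTranspose, frobSq_conjTranspose] at this

end Frobenius

lemma exists_eq_mul_diagonal_mul_conjTranspose {n : Type*} [Fintype n] [DecidableEq n]
    {A : Matrix n n ℂ} (hA : A.IsHermitian) :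
    ∃ W : Matrix n n ℂ, Wᴴ * W = 1 ∧ W * Wᴴ = 1 ∧
      A = W * diagonal (fun i => (hA.eigenvalues i : ℂ)) * Wᴴ := by
  refine ⟨(hA.eigenvectorUnitary : Matrix n n ℂ), mem_unitaryGroup_iff'.1 hA.eigenvectorUnitary.2,
    mem_unitaryGroup_iff.1 hA.eigenvectorUnitary.2, ?_⟩
  have h := hA.spectral_theorem
  rw [Unitary.conjStarAlgAut_apply] at h
  exact h

/-- The compact singular value decomposition. -/
lemma exists_compact_svd {m n : Type*} [Fintype m] [Fintype n] [DecidableEq n]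
    (U : Matrix m n ℂ) :
    ∃ (r : ℕ) (F : Matrix m (Fin r) ℂ) (σ : Fin r → ℝ) (E : Matrix n (Fin r) ℂ),
      (∀ i, 0 < σ i) ∧ Fᴴ * F = 1 ∧ Eᴴ * E = 1 ∧
        U = F * diagonal (fun i => (σ i : ℂ)) * Eᴴ := by
  have hA := isHermitian_conjTranspose_mul_self U
  have hpsd := posSemidef_conjTranspose_mul_self U
  obtain ⟨W, hWW, hWW', hAW⟩ := exists_eq_mul_diagonal_mul_conjTranspose hA
  set s := hA.eigenvalues with hs
  have hs0 : ∀ i, 0 ≤ s i := hpsd.eigenvalues_nonneg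
  have hdiag : (U * W)ᴴ * (U * W) = diagonal (fun i => (s i : ℂ)) := by
    rw [conjTranspose_mul, Matrix.mul_assoc, ← Matrix.mul_assoc Uᴴ, hAW,
      Matrix.mul_assoc, hWW, Matrix.mul_one, ← Matrix.mul_assoc, hWW, Matrix.one_mul]
  let ι := {i : n // 0 < s i}
  let e : Fin (Fintype.card ι) ≃ ι := (Fintype.equivFin ι).symm
  let E : Matrix n (Fin (Fintype.card ι)) ℂ := W.submatrix id (fun i => (e i : n))
  let σ : Fin (Fintype.card ι) → ℝ := fun i => √(s (e i))
  have hσ : ∀ i, 0 < σ i := fun i => Real.sqrt_pos.2 (e i).2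
  have hinj : ∀ i j, ((e i : n) = (e j : n)) ↔ i = j := fun i j => by
    rw [← Subtype.ext_iff, e.injective.eq_iff]
  have hEE : Eᴴ * E = 1 := by
    ext i j
    have := congrFun (congrFun hWW (e i)) (e j)
    simpa [E, Matrix.mul_apply, Matrix.one_apply, hinj] using this
  have hUE : (U * E)ᴴ * (U * E) = diagonal (fun i => ((σ i : ℂ)) ^ 2) := by
    ext i j
    have := congrFun (congrFun hdiag (e i)) (e j)
    have e1 : ∀ a j, (U * E) a j = (U * W) a (e j) := fun a j => by
      simp [E, Matrix.mul_apply]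
    have e2 : ((U * E)ᴴ * (U * E)) i j = ((U * W)ᴴ * (U * W)) (e i) (e j) := by
      simp only [Matrix.mul_apply (M := (U * E)ᴴ), Matrix.mul_apply (M := (U * W)ᴴ),
        conjTranspose_apply, e1]
    rw [e2, this, diagonal_apply, diagonal_apply]
    simp only [hinj]
    split_ifs with h
    · rw [← Complex.ofReal_pow, Real.sq_sqrt (hs0 _)]
    · rfl
  have hcol : ∀ k, ¬ 0 < s k → ∀ a, (U * W) a k = 0 := by
    intro k hk a
    have h0 : s k = 0 := le_antisymm (not_lt.1 hk) (hs0 k)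
    have := congrFun (congrFun hdiag k) k
    rw [diagonal_apply_eq, h0, Matrix.mul_apply] at this
    simp only [conjTranspose_apply] at this
    have h2 : ∑ a, ‖(U * W) a k‖ ^ 2 = 0 := by
      have h3 : ((∑ a, ‖(U * W) a k‖ ^ 2 : ℝ) : ℂ) = 0 := by
        rw [← Complex.ofReal_zero, ← this]
        push_cast
        refine Finset.sum_congr rfl fun a _ => ?_
        rw [← Complex.conj_mul']; rfl
      exact_mod_cast h3
    have := (Finset.sum_eq_zero_iff_of_nonneg (fun a _ => by positivity)).1 h2 a
      (Finset.mem_univ a)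
    simpa using this
  have hU : U = U * E * Eᴴ := by
    ext a b
    have h1 : U a b = ((U * W) * Wᴴ) a b := by rw [Matrix.mul_assoc, hWW', Matrix.mul_one]
    rw [h1, Matrix.mul_apply, Matrix.mul_apply]
    have h2 : ∀ j, (U * E) a j * Eᴴ j b = (U * W) a (e j) * Wᴴ (e j) b := fun j => by
      simp [E, Matrix.mul_apply]
    simp only [h2]
    rw [e.sum_comp (fun k : ι => (U * W) a k * Wᴴ k b),
      ← Finset.sum_subtype (Finset.univ.filter fun k => 0 < s k) (by simp)
        (fun k => (U * W) a k * Wᴴ k b), Finset.sum_filter_of_ne]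
    intro k _ hk
    by_contra h0
    exact hk (by rw [hcol k h0 a, zero_mul])
  refine ⟨_, U * E * diagonal (fun i => ((σ i)⁻¹ : ℂ)), σ, E, hσ, ?_, hEE, ?_⟩
  · rw [conjTranspose_mul, Matrix.mul_assoc, ← Matrix.mul_assoc (U * E)ᴴ, hUE,
      diagonal_conjTranspose, diagonal_mul_diagonal, diagonal_mul_diagonal, ← diagonal_one]
    congr 1
    ext i
    have : (σ i : ℂ) ≠ 0 := by exact_mod_cast (hσ i).ne'
    simp
    field_simp
  · rw [Matrix.mul_assoc (U * E), diagonal_mul_diagonal]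
    have : (fun i => ((σ i)⁻¹ : ℂ) * (σ i : ℂ)) = fun _ => 1 := by
      ext i
      have : (σ i : ℂ) ≠ 0 := by exact_mod_cast (hσ i).ne'
      field_simp
    rw [this, diagonal_one, Matrix.mul_one, ← hU]

/-- The residuals of the least-squares problems for the entries `(j, k)` and `(k, j)` of
`V ≈ Σ K` and of `V ≈ M Σ`, where `a, b` are the diagonal entries of `Σ` and `z, w` are the two
entries to be approximated: up to a term which changes sign under `(z, w) ↦ (i z, i w)`, they sum
to the squared norm. -/
lemma norm_sq_lyapunov_residual (a b : ℝ) (ha : 0 < a) (hb : 0 < b) (z w : ℂ) :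
    ‖z - a * (((a ^ 2 + b ^ 2)⁻¹ : ℝ) * (a * z + b * star w))‖ ^ 2 +
      ‖w - b * (((a ^ 2 + b ^ 2)⁻¹ : ℝ) * (b * w + a * star z))‖ ^ 2 +
      (‖z - (((a ^ 2 + b ^ 2)⁻¹ : ℝ) * (b * z + a * star w)) * b‖ ^ 2 +
      ‖w - (((a ^ 2 + b ^ 2)⁻¹ : ℝ) * (a * w + b * star z)) * a‖ ^ 2) =
      ‖z‖ ^ 2 + ‖w‖ ^ 2 - 4 * (a * b * (a ^ 2 + b ^ 2)⁻¹ * (z * w).re) := by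
  have hc : (a ^ 2 + b ^ 2)⁻¹ * (a ^ 2 + b ^ 2) = 1 := inv_mul_cancel₀ (by positivity)
  generalize (a ^ 2 + b ^ 2)⁻¹ = c at hc
  simp only [Complex.sq_norm, Complex.normSq_apply, Complex.sub_re, Complex.sub_im,
    Complex.mul_re, Complex.mul_im, Complex.add_re, Complex.add_im, Complex.ofReal_re,
    Complex.ofReal_im, Complex.star_def, Complex.conj_re, Complex.conj_im, zero_mul, sub_zero,
    add_zero]
  linear_combination ((z.re ^ 2 + z.im ^ 2 + w.re ^ 2 + w.im ^ 2) * (c * (a ^ 2 + b ^ 2) - 1) +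
    4 * a * b * c * (z.re * w.re - z.im * w.im)) * hc

lemma exists_isHermitian_approx_of_nonneg {r : ℕ} {σ : Fin r → ℝ} (hσ : ∀ i, 0 < σ i)
    (V : Matrix (Fin r) (Fin r) ℂ)
    (hV : 0 ≤ ∑ j, ∑ k, σ j * σ k * (σ j ^ 2 + σ k ^ 2)⁻¹ * (V j k * V k j).re) :
    ∃ K M : Matrix (Fin r) (Fin r) ℂ, K.IsHermitian ∧ M.IsHermitian ∧
      frobSq (V - diagonal (fun i => (σ i : ℂ)) * K) +
        frobSq (V - M * diagonal (fun i => (σ i : ℂ))) ≤ frobSq V := by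
  let K : Matrix (Fin r) (Fin r) ℂ := Matrix.of fun j k =>
    ((σ j ^ 2 + σ k ^ 2)⁻¹ : ℝ) * (σ j * V j k + σ k * star (V k j))
  let M : Matrix (Fin r) (Fin r) ℂ := Matrix.of fun j k =>
    ((σ j ^ 2 + σ k ^ 2)⁻¹ : ℝ) * (σ k * V j k + σ j * star (V k j))
  refine ⟨K, M, ?_, ?_, ?_⟩
  · ext j k
    simp only [K, conjTranspose_apply, Matrix.of_apply, star_mul', star_add, Complex.conj_conj,
      Complex.star_def, Complex.conj_ofReal]
    rw [add_comm (σ k ^ 2)]; ring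
  · ext j k
    simp only [M, conjTranspose_apply, Matrix.of_apply, star_mul', star_add, Complex.conj_conj,
      Complex.star_def, Complex.conj_ofReal]
    rw [add_comm (σ k ^ 2)]; ring
  · have hsymm : ∀ f : Fin r → Fin r → ℝ, 2 * ∑ j, ∑ k, f j k = ∑ j, ∑ k, (f j k + f k j) := by
      intro f
      simp only [Finset.sum_add_distrib]
      rw [Finset.sum_comm (f := fun j k => f k j)]; ring
    have key : 2 * (frobSq (V - diagonal (fun i => (σ i : ℂ)) * K) +
        frobSq (V - M * diagonal (fun i => (σ i : ℂ)))) = 2 * frobSq V -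
        4 * ∑ j, ∑ k, σ j * σ k * (σ j ^ 2 + σ k ^ 2)⁻¹ * (V j k * V k j).re := by
      unfold frobSq
      rw [← Finset.sum_add_distrib]
      simp only [← Finset.sum_add_distrib]
      rw [hsymm, hsymm, Finset.mul_sum, ← Finset.sum_sub_distrib]
      refine Finset.sum_congr rfl fun j _ => ?_
      rw [Finset.mul_sum, ← Finset.sum_sub_distrib]
      refine Finset.sum_congr rfl fun k _ => ?_
      rw [← norm_sq_lyapunov_residual (σ j) (σ k) (hσ j) (hσ k) (V j k) (V k j)]
      simp only [K, M, Matrix.sub_apply, diagonal_mul, mul_diagonal, Matrix.of_apply,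
        add_comm (σ k ^ 2) (σ j ^ 2)]
      ring
    linarith

/-- For a positive diagonal `Σ`, the errors of the best approximations `Σ K` and `M Σ` of `V`
by Hermitian `K` and `M` add up to at most `‖V‖²`, after a common choice of phase. Averaged over
the phase of `V`, the entry `V j k` is captured in the proportions
`σ j ^ 2 : σ k ^ 2` by the two approximations. -/
lemma exists_isHermitian_approx {r : ℕ} {σ : Fin r → ℝ} (hσ : ∀ i, 0 < σ i)
    (V : Matrix (Fin r) (Fin r) ℂ) :
    ∃ (ω : ℂ) (K M : Matrix (Fin r) (Fin r) ℂ), K.IsHermitian ∧ M.IsHermitian ∧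
      frobSq (V - ω • (diagonal (fun i => (σ i : ℂ)) * K)) +
        frobSq (V - ω • (M * diagonal (fun i => (σ i : ℂ)))) ≤ frobSq V := by
  rcases le_total 0 (∑ j, ∑ k, σ j * σ k * (σ j ^ 2 + σ k ^ 2)⁻¹ * (V j k * V k j).re) with h | h
  · obtain ⟨K, M, hK, hM, hle⟩ := exists_isHermitian_approx_of_nonneg hσ V h
    exact ⟨1, K, M, hK, hM, by simpa using hle⟩
  · -- Multiplication of `V` by `i` flips the sign of the quadratic form.
    obtain ⟨K, M, hK, hM, hle⟩ := exists_isHermitian_approx_of_nonneg hσ (Complex.I • V) (by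
      have : ∀ j k, ((Complex.I • V) j k * (Complex.I • V) k j).re = -(V j k * V k j).re := by
        intro j k
        simp only [Matrix.smul_apply, smul_eq_mul]
        rw [mul_mul_mul_comm, Complex.I_mul_I]; simp
      simp only [this, mul_neg, Finset.sum_neg_distrib]
      linarith)
    refine ⟨-Complex.I, K, M, hK, hM, ?_⟩
    have h1 : ∀ X : Matrix (Fin r) (Fin r) ℂ,
        frobSq (V - (-Complex.I) • X) = frobSq (Complex.I • V - X) := by
      intro X
      have : Complex.I • V - X = Complex.I • (V - (-Complex.I) • X) := by
        rw [smul_sub, smul_smul]; simp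
      rw [this, frobSq_smul]; simp
    rw [h1, h1]
    rw [frobSq_smul] at hle
    simpa using hle

/-- A Parseval frame of the space `n → ℂ`, given by the columns of `C`, in which the pair of
columns `u, v` of `U * C` and `V * C` is either trivial (`u = 0`) or has `v` within squared
distance `t` of the line through `u`; the numbers `t` add up to at most `y`. Measuring this frame
yields an ensemble whose Schur complements with respect to `U` have total weight at most `y`. -/
def HasSchurFrame {m n : Type*} [Fintype m] [Fintype n] [DecidableEq n] (U V : Matrix m n ℂ)
    (y : ℝ) : Prop :=
  ∃ (r : ℕ) (C : Matrix n (Fin r ⊕ n) ℂ) (t : Fin r ⊕ n → ℝ), C * Cᴴ = 1 ∧ (∀ k, 0 ≤ t k) ∧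
    ∑ k, t k ≤ y ∧ ∀ k, (∀ b, (U * C) b k = 0) ∨
      ∃ s : ℂ, ∑ b, ‖(V * C) b k - s * (U * C) b k‖ ^ 2 ≤ t k

section SchurFrame
variable {m n : Type*} [Fintype m] [Fintype n] [DecidableEq n]

/-- The frame consists of the eigenvectors of the Hermitian matrix `K`, transported to the
support of `U`, together with a frame of the kernel of `U`. -/
lemma hasSchurFrame_of_isHermitian {r : ℕ} {U V : Matrix m n ℂ} {F : Matrix m (Fin r) ℂ}
    {D : Matrix (Fin r) (Fin r) ℂ} {E : Matrix n (Fin r) ℂ} (hE : Eᴴ * E = 1)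
    (hU : U = F * D * Eᴴ) {K : Matrix (Fin r) (Fin r) ℂ} (hK : K.IsHermitian) (ω : ℂ) :
    HasSchurFrame U V (frobSq (V * E - F * (ω • (D * K)))) := by
  obtain ⟨W, hWW, hWW', hKW⟩ := exists_eq_mul_diagonal_mul_conjTranspose hK
  set l := hK.eigenvalues
  have hKW' : K * W = W * diagonal (fun i => (l i : ℂ)) := by
    rw [hKW, Matrix.mul_assoc, hWW, Matrix.mul_one]
  have hUE : U * E = F * D := by rw [hU, Matrix.mul_assoc, hE, Matrix.mul_one]
  have hUQ : U * (1 - E * Eᴴ) = 0 := by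
    rw [Matrix.mul_sub, Matrix.mul_one, ← Matrix.mul_assoc, hUE, ← hU, sub_self]
  let C : Matrix n (Fin r ⊕ n) ℂ := fromCols (E * W) (1 - E * Eᴴ)
  let R : Matrix m (Fin r) ℂ := (V * E - F * (ω • (D * K))) * W
  refine ⟨r, C, Sum.elim (fun i => ∑ b, ‖R b i‖ ^ 2) (fun _ => 0), ?_, ?_, ?_, ?_⟩
  · have hQ : (1 - E * Eᴴ) * (1 - E * Eᴴ)ᴴ = 1 - E * Eᴴ := by
      have h2 : (E * Eᴴ) * (E * Eᴴ) = E * Eᴴ := by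
        rw [Matrix.mul_assoc, ← Matrix.mul_assoc Eᴴ, hE, Matrix.one_mul]
      rw [conjTranspose_sub, conjTranspose_one, conjTranspose_mul, conjTranspose_conjTranspose,
        Matrix.mul_sub, Matrix.mul_one, Matrix.sub_mul, Matrix.one_mul, h2]
      simp
    have hEW : (E * W) * (E * W)ᴴ = E * Eᴴ := by
      rw [conjTranspose_mul, Matrix.mul_assoc, ← Matrix.mul_assoc W, hWW', Matrix.one_mul]
    simp only [C]
    rw [conjTranspose_fromCols_eq_fromRows_conjTranspose, fromCols_mul_fromRows, hEW, hQ]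
    simp
  · rintro (i | j)
    · exact Finset.sum_nonneg fun _ _ => sq_nonneg _
    · exact le_rfl
  · rw [Fintype.sum_sum_type]
    simp only [Sum.elim_inl, Sum.elim_inr, Finset.sum_const_zero, add_zero]
    rw [Finset.sum_comm]
    exact (frobSq_mul_of_mul_conjTranspose _ hWW').le
  · rintro (i | j)
    · right
      refine ⟨ω * l i, le_of_eq ?_⟩
      simp only [Sum.elim_inl]
      refine Finset.sum_congr rfl fun b _ => ?_
      congr 2
      have h1 : (V * C) b (Sum.inl i) = (V * E * W) b i := by
        simp only [C, mul_fromCols, fromCols_apply_inl, Matrix.mul_assoc]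
      have h2 : (U * C) b (Sum.inl i) = (F * D * W) b i := by
        simp only [C, mul_fromCols, fromCols_apply_inl]
        rw [← Matrix.mul_assoc, hUE]
      have h3 : R = V * E * W - ω • (F * D * W * diagonal (fun i => (l i : ℂ))) := by
        simp only [R]
        rw [Matrix.sub_mul, Matrix.mul_smul, Matrix.smul_mul, Matrix.mul_assoc F,
          Matrix.mul_assoc D, hKW']
        simp only [Matrix.mul_assoc]
      rw [h1, h2, h3, Matrix.sub_apply, Matrix.smul_apply, mul_diagonal, smul_eq_mul]
      ring
    · left
      intro b
      simp only [C, mul_fromCols, fromCols_apply_inr, hUQ, Matrix.zero_apply]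

/-- The two complementary sides of a pair of matrices have Schur frames whose weights add up to
at most the squared norm of the second matrix. -/
lemma exists_hasSchurFrame [DecidableEq m] (U V : Matrix m n ℂ) :
    ∃ y₁ y₂ : ℝ, 0 ≤ y₁ ∧ 0 ≤ y₂ ∧ y₁ + y₂ ≤ frobSq V ∧
      HasSchurFrame U V y₁ ∧ HasSchurFrame Uᵀ Vᵀ y₂ := by
  obtain ⟨r, F, σ, E, hσ, hF, hE, hU⟩ := exists_compact_svd U
  set D : Matrix (Fin r) (Fin r) ℂ := diagonal (fun i => (σ i : ℂ)) with hD
  obtain ⟨ω, K, M, hK, hM, hle⟩ := exists_isHermitian_approx hσ (Fᴴ * V * E)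
  rw [← hD] at hle
  have hE' : Eᴴᵀᴴ = Eᵀ := by ext; simp
  have hF' : Fᴴᵀᴴ = Fᵀ := by ext; simp
  have hEE' : Eᴴᵀᴴ * Eᴴᵀ = 1 := by rw [hE', ← transpose_mul, hE, transpose_one]
  have hFF' : Fᴴᵀᴴ * Fᴴᵀ = 1 := by rw [hF', ← transpose_mul, hF, transpose_one]
  have hU' : Uᵀ = Eᴴᵀ * D * Fᴴᵀᴴ := by
    rw [hF', hU, transpose_mul, transpose_mul, hD, diagonal_transpose, Matrix.mul_assoc]
  have e1 : frobSq (V * E - F * (ω • (D * K))) =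
      frobSq (V * E) - frobSq (Fᴴ * V * E) + frobSq (Fᴴ * V * E - ω • (D * K)) := by
    rw [frobSq_sub_mul hF, Matrix.mul_assoc]
  have e2 : frobSq (Vᵀ * Fᴴᵀ - Eᴴᵀ * (ω • (D * Mᵀ))) =
      frobSq (Fᴴ * V) - frobSq (Fᴴ * V * E) + frobSq (Fᴴ * V * E - ω • (M * D)) := by
    rw [frobSq_sub_mul hEE', hE', ← transpose_mul, ← transpose_mul, frobSq_transpose,
      frobSq_transpose, ← frobSq_transpose (Fᴴ * V * E - ω • (M * D)), transpose_sub,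
      transpose_smul, transpose_mul M, hD, diagonal_transpose]
  have e3 : frobSq (V * E) + frobSq (Fᴴ * V) ≤ frobSq V + frobSq (Fᴴ * V * E) := by
    have h1 := frobSq_mul_le hE (V - F * (Fᴴ * V))
    rw [Matrix.sub_mul, Matrix.mul_assoc F, frobSq_sub_mul hF, frobSq_sub_mul hF,
      ← Matrix.mul_assoc] at h1
    simp only [sub_self, frobSq_zero, add_zero] at h1
    linarith
  refine ⟨_, _, frobSq_nonneg _, frobSq_nonneg _, ?_, hasSchurFrame_of_isHermitian hE hU hK ω,
    hasSchurFrame_of_isHermitian hFF' hU' hM.transpose ω⟩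
  rw [e1, e2]
  linarith

end SchurFrame

/-! ### Qubit-qudit pure states -/

section Qubit
variable {β : Type*} [Fintype β]

lemma frobSq_coeffMatrix (w : Fin 2 × β → ℂ) : frobSq (coeffMatrix w) = ∑ x, ‖w x‖ ^ 2 :=
  (Fintype.sum_prod_type (f := fun x => ‖w x‖ ^ 2)).symm

/-- The two eigenvalues of the reduced state of a qubit. -/
lemma exists_eigenvalues (w : Fin 2 × β → ℂ) :
    ∃ x y : ℝ, 0 ≤ x ∧ 0 ≤ y ∧ x + y = frobSq (coeffMatrix w) ∧
      ((x * y : ℝ) : ℂ) = (reducedA w).det ∧ ∀ q, trPowA q w = x ^ q + y ^ q := by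
  have hpsd : (reducedA w).PosSemidef := posSemidef_self_mul_conjTranspose _
  refine ⟨_, _, hpsd.eigenvalues_nonneg 0, hpsd.eigenvalues_nonneg 1, ?_, ?_, fun q => ?_⟩
  · have h := hpsd.1.trace_eq_sum_eigenvalues
    have htr : (reducedA w).trace = frobSq (coeffMatrix w) := by
      rw [reducedA, trace_mul_comm, ← ofReal_frobSq]
    rw [htr, Fin.sum_univ_two] at h
    apply Complex.ofReal_injective
    rw [Complex.ofReal_add]
    exact h.symm
  · have h := hpsd.1.det_eq_prod_eigenvalues
    rw [Fin.prod_univ_two] at h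
    rw [h]; push_cast; rfl
  · rw [trPowA, Fin.sum_univ_two]

lemma gqPure_eq_gqPair {q x y : ℝ} {φ : Fin 2 × β → ℂ} (hφ : IsUnitVec φ)
    (hadd : x + y = frobSq (coeffMatrix φ)) (hpow : trPowA q φ = x ^ q + y ^ q) :
    gqPure q φ = gqPair q x y := by
  rw [frobSq_coeffMatrix, show ∑ x, ‖φ x‖ ^ 2 = 1 from hφ] at hadd
  rw [gqPure, gqPair, powDefect, hadd, hpow, Real.one_rpow, sub_sub]

lemma gqPure_nonneg {q : ℝ} (hq : 1 ≤ q) {φ : Fin 2 × β → ℂ} (hφ : IsUnitVec φ) :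
    0 ≤ gqPure q φ := by
  obtain ⟨x, y, hx, hy, hadd, -, hpow⟩ := exists_eigenvalues φ
  rw [gqPure_eq_gqPair hφ hadd (hpow q)]
  exact gqPair_nonneg hq hx hy

/-- The Gram determinant of `u, v` is at most `‖u‖² ‖v - s u‖²`. -/
lemma gram_le (u v : β → ℂ) (s : ℂ) :
    (∑ b, ‖u b‖ ^ 2) * (∑ b, ‖v b‖ ^ 2) - ‖∑ b, u b * star (v b)‖ ^ 2 ≤
      (∑ b, ‖u b‖ ^ 2) * ∑ b, ‖v b - s * u b‖ ^ 2 := by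
  set P := ∑ b, ‖u b‖ ^ 2
  set n := ∑ b, u b * star (v b) with hn
  have h1 : ∑ b, ‖v b - s * u b‖ ^ 2 = ∑ b, ‖v b‖ ^ 2 - 2 * (s * n).re + ‖s‖ ^ 2 * P := by
    have : ∀ b, ‖v b - s * u b‖ ^ 2 =
        ‖v b‖ ^ 2 - 2 * (s * (u b * star (v b))).re + ‖s‖ ^ 2 * ‖u b‖ ^ 2 := by
      intro b
      simp only [Complex.sq_norm, Complex.normSq_apply, Complex.sub_re, Complex.sub_im,
        Complex.mul_re, Complex.mul_im, Complex.star_def, Complex.conj_re, Complex.conj_im]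
      ring
    simp only [this, Finset.sum_add_distrib, Finset.sum_sub_distrib, ← Finset.mul_sum, P, hn,
      ← Complex.re_sum]
  have h2 : 0 ≤ ‖star n - s * P‖ ^ 2 := by positivity
  have h3 : ‖star n - s * P‖ ^ 2 = ‖n‖ ^ 2 - 2 * P * (s * n).re + ‖s‖ ^ 2 * P ^ 2 := by
    simp only [Complex.sq_norm, Complex.normSq_apply, Complex.sub_re, Complex.sub_im,
      Complex.mul_re, Complex.mul_im, Complex.star_def, Complex.conj_re, Complex.conj_im,
      Complex.ofReal_re, Complex.ofReal_im]
    ring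
  rw [h1]
  nlinarith

lemma ofReal_sum_norm_sq (u : β → ℂ) : ((∑ b, ‖u b‖ ^ 2 : ℝ) : ℂ) = ∑ b, u b * star (u b) := by
  push_cast
  exact Finset.sum_congr rfl fun b _ => by rw [Complex.star_def, Complex.mul_conj']

/-- Upper bound for the contribution of one unnormalized vector `w = √p φ` to an ensemble, in
terms of its two components `u, v` in an arbitrary orthonormal basis of the qubit. -/
lemma mul_gqPure_le {q p t : ℝ} (hq1 : 1 ≤ q) (hq2 : q ≤ 2) (hp : 0 ≤ p) (ht : 0 ≤ t)
    {φ w : Fin 2 × β → ℂ} (hφ : IsUnitVec φ) (hw : ∀ x, w x = (√p : ℝ) * φ x)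
    {g : Matrix (Fin 2) (Fin 2) ℂ} (hg : gᴴ * g = 1) {u v : β → ℂ}
    (hu : ∀ b, u b = (g * coeffMatrix w) 0 b) (hv : ∀ b, v b = (g * coeffMatrix w) 1 b)
    (h : (∀ b, u b = 0) ∨ ∃ s : ℂ, ∑ b, ‖v b - s * u b‖ ^ 2 ≤ t) :
    p * gqPure q φ ≤ gqPair q (∑ b, ‖u b‖ ^ 2) t := by
  obtain ⟨x, y, hx, hy, hadd, hdet, hpow⟩ := exists_eigenvalues φ
  rw [gqPure_eq_gqPair hφ hadd (hpow q), ← gqPair_smul hq1 hp hx hy]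
  have hcoeff : coeffMatrix w = ((√p : ℝ) : ℂ) • coeffMatrix φ := by
    ext a b; simp [coeffMatrix, hw]
  have hsq : ((√p : ℝ) : ℂ) * ((√p : ℝ) : ℂ) = (p : ℂ) := by
    rw [← Complex.ofReal_mul, Real.mul_self_sqrt hp]
  have hP : 0 ≤ ∑ b, ‖u b‖ ^ 2 := by positivity
  have hsum : p * x + p * y = ∑ b, ‖u b‖ ^ 2 + ∑ b, ‖v b‖ ^ 2 := by
    have h1 : frobSq (g * coeffMatrix w) = frobSq (coeffMatrix w) :=
      frobSq_mul_of_conjTranspose_mul hg _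
    have h2 : frobSq (coeffMatrix w) = p * frobSq (coeffMatrix φ) := by
      rw [hcoeff, frobSq_smul, Complex.norm_real, Real.norm_eq_abs, sq_abs, Real.sq_sqrt hp]
    rw [← mul_add, hadd, ← h2, ← h1, frobSq, Fin.sum_univ_two]
    simp only [hu, hv]
  have hgram : (p * x) * (p * y) =
      (∑ b, ‖u b‖ ^ 2) * (∑ b, ‖v b‖ ^ 2) - ‖∑ b, u b * star (v b)‖ ^ 2 := by
    have h1 : ((g * coeffMatrix w) * (g * coeffMatrix w)ᴴ).det = (p : ℂ) ^ 2 * (reducedA φ).det := by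
      have : (g * coeffMatrix w) * (g * coeffMatrix w)ᴴ = g * ((p : ℂ) • reducedA φ) * gᴴ := by
        rw [hcoeff, conjTranspose_mul, conjTranspose_smul, reducedA, ← hsq]
        simp only [Complex.star_def, Complex.conj_ofReal, Matrix.mul_smul, Matrix.smul_mul,
          smul_smul, Matrix.mul_assoc]
      rw [this, det_mul, det_mul, det_smul, Fintype.card_fin]
      have hd : gᴴ.det * g.det = 1 := by rw [← det_mul, hg, det_one]
      linear_combination ((p : ℂ) ^ 2 * (reducedA φ).det) * hd
    have h2 : ((g * coeffMatrix w) * (g * coeffMatrix w)ᴴ).det =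
        (((∑ b, ‖u b‖ ^ 2) * (∑ b, ‖v b‖ ^ 2) - ‖∑ b, u b * star (v b)‖ ^ 2 : ℝ) : ℂ) := by
      have hn : star (∑ b, u b * star (v b)) = ∑ b, v b * star (u b) := by
        simp [mul_comm]
      rw [det_fin_two]
      simp only [Matrix.mul_apply (M := g * coeffMatrix w), conjTranspose_apply, ← hu, ← hv]
      rw [Complex.ofReal_sub, Complex.ofReal_mul, ofReal_sum_norm_sq, ofReal_sum_norm_sq,
        Complex.ofReal_pow, ← Complex.mul_conj', ← Complex.star_def, hn]
    rw [h2, ← hdet] at h1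
    have h3 : (((∑ b, ‖u b‖ ^ 2) * (∑ b, ‖v b‖ ^ 2) - ‖∑ b, u b * star (v b)‖ ^ 2 : ℝ) : ℂ) =
        ((p ^ 2 * (x * y) : ℝ) : ℂ) := by rw [h1]; push_cast; ring
    have h4 := Complex.ofReal_injective h3
    linarith
  refine gqPair_le_of_schur hq1 hq2 (by positivity) (by positivity) hP ht hsum ?_ ?_
  · rw [hgram]
    linarith [sq_nonneg ‖∑ b, u b * star (v b)‖]
  · rw [hgram]
    rcases h with h | ⟨s, hs⟩
    · simp [h]
    · exact (gram_le u v s).trans (mul_le_mul_of_nonneg_left hs hP)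

/-- An orthonormal basis of the qubit which diagonalizes its reduced state, the larger
eigenvalue first. -/
lemma exists_schmidt_basis (q : ℝ) {ψ : Fin 2 × β → ℂ} (hψ : IsUnitVec ψ) :
    ∃ g : Matrix (Fin 2) (Fin 2) ℂ, gᴴ * g = 1 ∧
      ∑ b, ‖(g * coeffMatrix ψ) 1 b‖ ^ 2 ≤ ∑ b, ‖(g * coeffMatrix ψ) 0 b‖ ^ 2 ∧
      gqPure q ψ = gqPair q (∑ b, ‖(g * coeffMatrix ψ) 0 b‖ ^ 2)
        (∑ b, ‖(g * coeffMatrix ψ) 1 b‖ ^ 2) := by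
  obtain ⟨W, hWW, hWW', hW⟩ := exists_eq_mul_diagonal_mul_conjTranspose (reducedA_isHermitian ψ)
  set s := (reducedA_isHermitian ψ).eigenvalues with hs
  have hrow : ∀ i, ∑ b, ‖(Wᴴ * coeffMatrix ψ) i b‖ ^ 2 = s i := by
    intro i
    have h1 : (Wᴴ * coeffMatrix ψ) * (Wᴴ * coeffMatrix ψ)ᴴ = diagonal (fun i => (s i : ℂ)) := by
      rw [conjTranspose_mul, conjTranspose_conjTranspose, Matrix.mul_assoc,
        ← Matrix.mul_assoc (coeffMatrix ψ), ← reducedA, hW, Matrix.mul_assoc, hWW,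
        Matrix.mul_one, ← Matrix.mul_assoc, hWW, Matrix.one_mul]
    have h2 := congrFun (congrFun h1 i) i
    rw [diagonal_apply_eq, Matrix.mul_apply] at h2
    simp only [conjTranspose_apply] at h2
    rw [← ofReal_sum_norm_sq] at h2
    exact_mod_cast h2
  have hfrob : s 0 + s 1 = frobSq (coeffMatrix ψ) := by
    rw [← hrow, ← hrow, ← frobSq_mul_of_conjTranspose_mul (F := Wᴴ)
      (by rwa [conjTranspose_conjTranspose]) (coeffMatrix ψ), frobSq, Fin.sum_univ_two]
  have hgq : gqPure q ψ = gqPair q (s 0) (s 1) :=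
    gqPure_eq_gqPair hψ hfrob (by rw [trPowA, Fin.sum_univ_two])
  rcases le_total (s 1) (s 0) with h | h
  · exact ⟨Wᴴ, by rwa [conjTranspose_conjTranspose], by rwa [hrow, hrow], by rwa [hrow, hrow]⟩
  · have hsub : ∀ i b, (Wᴴ.submatrix (Equiv.swap (0 : Fin 2) 1) id * coeffMatrix ψ) i b =
        (Wᴴ * coeffMatrix ψ) (Equiv.swap 0 1 i) b := fun i b => by
      simp [Matrix.mul_apply]
    refine ⟨Wᴴ.submatrix (Equiv.swap (0 : Fin 2) 1) id, ?_, ?_, ?_⟩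
    · rw [conjTranspose_submatrix, conjTranspose_conjTranspose, submatrix_mul_equiv, hWW']
      simp
    · simp only [hsub, hrow, Equiv.swap_apply_left, Equiv.swap_apply_right]; exact h
    · simp only [hsub, hrow, Equiv.swap_apply_left, Equiv.swap_apply_right]
      rw [hgq, gqPair_comm]

end Qubit

/-! ### Convex roofs -/

section Roof
variable {ι : Type*} [Fintype ι] {E : (ι → ℂ) → ℝ}

lemma sum_mem_roofValues_of_decomposition {κ : Type*} [Fintype κ] {p : κ → ℝ} {φ : κ → ι → ℂ}
    (hp : ∀ k, 0 ≤ p k) (hsum : ∑ k, p k = 1) (hφ : ∀ k, IsUnitVec (φ k)) :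
    ∑ k, p k * E (φ k) ∈ roofValues E (∑ k, (p k : ℂ) • proj (φ k)) := by
  let e := (Fintype.equivFin κ).symm
  refine ⟨Fintype.card κ, p ∘ e, φ ∘ e, ⟨fun i => hp _, ?_, fun i => hφ _, ?_⟩, ?_⟩
  · rw [← hsum]; exact e.sum_comp p
  · exact (e.sum_comp fun k => (p k : ℂ) • proj (φ k)).symm
  · exact (e.sum_comp fun k => p k * E (φ k)).symm

/-- Convexity of the convex roof, on the level of attained values. -/
lemma sum_mem_roofValues {κ : Type*} [Fintype κ] {p : κ → ℝ} {ρ : κ → Matrix ι ι ℂ} {v : κ → ℝ}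
    (hp : ∀ k, 0 ≤ p k) (hsum : ∑ k, p k = 1) (hv : ∀ k, v k ∈ roofValues E (ρ k)) :
    ∑ k, p k * v k ∈ roofValues E (∑ k, (p k : ℂ) • ρ k) := by
  choose m r φ hdec hval using hv
  have h := sum_mem_roofValues_of_decomposition (E := E) (κ := Σ k, Fin (m k))
    (p := fun x => p x.1 * r x.1 x.2) (φ := fun x => φ x.1 x.2)
    (fun x => mul_nonneg (hp _) ((hdec _).nonneg _))
    (by simp only [Fintype.sum_sigma, ← Finset.mul_sum, (hdec _).sum_eq_one, mul_one, hsum])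
    (fun x => (hdec _).unit _)
  simp only [Fintype.sum_sigma] at h
  convert h using 2
  · refine Finset.sum_congr rfl fun k _ => ?_
    rw [(hdec k).sum_eq, Finset.smul_sum]
    refine Finset.sum_congr rfl fun i _ => ?_
    rw [smul_smul, Complex.ofReal_mul]
  · rw [hval, Finset.mul_sum]
    exact Finset.sum_congr rfl fun i _ => (mul_assoc _ _ _).symm

/-- An ensemble of unnormalized vectors, rewritten as a pure-state decomposition. -/
lemma exists_normalized_ensemble {κ : Type*} [Fintype κ] (w : κ → ι → ℂ)
    (hw : ∑ k, ∑ i, ‖w k i‖ ^ 2 = 1) :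
    ∃ φ : κ → ι → ℂ, (∀ k, IsUnitVec (φ k)) ∧
      (∀ k x, w k x = (√(∑ i, ‖w k i‖ ^ 2) : ℝ) * φ k x) ∧
      ∑ k, (∑ i, ‖w k i‖ ^ 2) * E (φ k) ∈ roofValues E (∑ k, proj (w k)) := by
  classical
  have hne : Nonempty ι := by
    by_contra h
    rw [not_nonempty_iff] at h
    simp at hw
  obtain ⟨i₀⟩ := hne
  have hex : ∀ k, ∃ φ : ι → ℂ, IsUnitVec φ ∧ ∀ x, w k x = (√(∑ i, ‖w k i‖ ^ 2) : ℝ) * φ x := by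
    intro k
    have hT : 0 ≤ ∑ i, ‖w k i‖ ^ 2 := by positivity
    rcases hT.eq_or_lt with h | h
    · refine ⟨Pi.single i₀ 1, ?_, fun x => ?_⟩
      · rw [IsUnitVec, Finset.sum_eq_single i₀] <;> simp +contextual
      · have := (Finset.sum_eq_zero_iff_of_nonneg (fun i _ => by positivity)).1 h.symm x
          (Finset.mem_univ x)
        have h0 : w k x = 0 := by simpa using this
        rw [← h, h0]; simp
    · have hs : (√(∑ i, ‖w k i‖ ^ 2) : ℝ) ≠ 0 := (Real.sqrt_pos.2 h).ne'
      have hs' : ((√(∑ i, ‖w k i‖ ^ 2) : ℝ) : ℂ) ≠ 0 := by exact_mod_cast hs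
      refine ⟨fun x => w k x / (√(∑ i, ‖w k i‖ ^ 2) : ℝ), ?_, fun x => ?_⟩
      · simp only [IsUnitVec, norm_div, Complex.norm_real, Real.norm_eq_abs, div_pow, sq_abs,
          Real.sq_sqrt hT, ← Finset.sum_div]
        exact div_self h.ne'
      · field_simp
  choose φ hφ hwφ using hex
  refine ⟨φ, hφ, hwφ, ?_⟩
  have h := sum_mem_roofValues_of_decomposition (E := E) (p := fun k => ∑ i, ‖w k i‖ ^ 2)
    (φ := φ) (fun k => by positivity) hw hφ
  convert h using 2
  refine Finset.sum_congr rfl fun k _ => ?_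
  ext x y
  have hsq : ((√(∑ i, ‖w k i‖ ^ 2) : ℝ) : ℂ) * ((√(∑ i, ‖w k i‖ ^ 2) : ℝ) : ℂ) =
      ((∑ i, ‖w k i‖ ^ 2 : ℝ) : ℂ) := by
    rw [← Complex.ofReal_mul, Real.mul_self_sqrt (by positivity)]
  simp only [proj, vecMulVec_apply, Matrix.smul_apply, Pi.star_apply, smul_eq_mul]
  rw [hwφ k x, hwφ k y, ← hsq, star_mul', Complex.star_def, Complex.conj_ofReal]
  ring

/-- Every state has a pure-state decomposition, by the spectral theorem. -/
lemma IsState.roofValues_nonempty {ρ : Matrix ι ι ℂ} (hρ : IsState ρ) :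
    (roofValues E ρ).Nonempty := by
  classical
  obtain ⟨W, hWW, -, hW⟩ := exists_eq_mul_diagonal_mul_conjTranspose hρ.1.1
  set s := hρ.1.1.eigenvalues with hs
  have hsum : ∑ k, s k = 1 := by
    have h2 : ((∑ k, s k : ℝ) : ℂ) = 1 := by
      rw [← hρ.2, hρ.1.1.trace_eq_sum_eigenvalues]; push_cast; rfl
    exact_mod_cast h2
  have hunit : ∀ k, IsUnitVec (fun i => W i k) := by
    intro k
    have h := congrFun (congrFun hWW k) k
    rw [Matrix.one_apply_eq, Matrix.mul_apply] at h
    simp only [conjTranspose_apply] at h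
    have h2 : ((∑ i, ‖W i k‖ ^ 2 : ℝ) : ℂ) = 1 := by
      rw [← h, ofReal_sum_norm_sq]
      exact Finset.sum_congr rfl fun i _ => mul_comm _ _
    exact_mod_cast h2
  have h := sum_mem_roofValues_of_decomposition (E := E) (p := s) (φ := fun k i => W i k)
    hρ.1.eigenvalues_nonneg hsum hunit
  have hdec : ρ = ∑ k, (s k : ℂ) • proj fun i => W i k := by
    refine hW.trans ?_
    ext x y
    rw [Matrix.mul_apply]
    simp only [mul_diagonal, conjTranspose_apply, Matrix.sum_apply, Matrix.smul_apply, proj,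
      vecMulVec_apply, Pi.star_apply, smul_eq_mul]
    exact Finset.sum_congr rfl fun k _ => by ring
  rw [hdec]
  exact ⟨_, h⟩

end Roof

lemma roofValues_gqPure_nonneg {β : Type*} [Fintype β] {q x : ℝ} (hq : 1 ≤ q)
    {ρ : Matrix (Fin 2 × β) (Fin 2 × β) ℂ} (hx : x ∈ roofValues (gqPure q) ρ) : 0 ≤ x := by
  obtain ⟨m, p, φ, hdec, rfl⟩ := hx
  exact Finset.sum_nonneg fun i _ => mul_nonneg (hdec.nonneg i) (gqPure_nonneg hq (hdec.unit i))

lemma gqConcurrence_le {β : Type*} [Fintype β] {q x : ℝ} (hq : 1 ≤ q)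
    {ρ : Matrix (Fin 2 × β) (Fin 2 × β) ℂ} (hx : x ∈ roofValues (gqPure q) ρ) :
    gqConcurrence q ρ ≤ x :=
  csInf_le ⟨0, fun _ hy => roofValues_gqPure_nonneg hq hy⟩ hx

lemma gqConcurrence_nonneg {β : Type*} [Fintype β] {q : ℝ} (hq : 1 ≤ q)
    (ρ : Matrix (Fin 2 × β) (Fin 2 × β) ℂ) : 0 ≤ gqConcurrence q ρ :=
  Real.sInf_nonneg fun _ hy => roofValues_gqPure_nonneg hq hy

/-! ### Tripartite systems -/

section Tripartite
variable {β γ δ : Type*} [Fintype γ]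

/-- The reduced state on the qubit and the factor `β` of the other system `δ ≃ β × γ`: the
factor `γ` is traced out. -/
def trRight (e : δ ≃ β × γ) (ρ : Matrix (Fin 2 × δ) (Fin 2 × δ) ℂ) :
    Matrix (Fin 2 × β) (Fin 2 × β) ℂ :=
  Matrix.of fun x y => ∑ c, ρ (x.1, e.symm (x.2, c)) (y.1, e.symm (y.2, c))

lemma trRight_sum_smul (e : δ ≃ β × γ) {κ : Type*} [Fintype κ] (p : κ → ℂ)
    (ρ : κ → Matrix (Fin 2 × δ) (Fin 2 × δ) ℂ) :
    trRight e (∑ k, p k • ρ k) = ∑ k, p k • trRight e (ρ k) := by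
  ext x y
  simp only [trRight, Matrix.of_apply, Matrix.sum_apply, Matrix.smul_apply, Finset.smul_sum]
  exact Finset.sum_comm

variable [Fintype β] [Fintype δ]

/-- A vector of the second system `δ ≃ β × γ` as a `β × γ` matrix. -/
def tensorMatrix (e : δ ≃ β × γ) (f : δ → ℂ) : Matrix β γ ℂ :=
  Matrix.of fun b c => f (e.symm (b, c))

lemma frobSq_tensorMatrix (e : δ ≃ β × γ) (f : δ → ℂ) :
    frobSq (tensorMatrix e f) = ∑ x, ‖f x‖ ^ 2 := by
  rw [← e.symm.sum_comp, Fintype.sum_prod_type]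
  rfl

/-- Measuring a Schur frame on the system `γ` gives an ensemble for the reduced state of the
qubit and `β`, with a controlled average `G_q`-concurrence. -/
lemma exists_roofValue_le [DecidableEq γ] {q y : ℝ} (hq1 : 1 ≤ q) (hq2 : q ≤ 2)
    (e : δ ≃ β × γ) {ψ : Fin 2 × δ → ℂ} (hψ : IsUnitVec ψ) {g : Matrix (Fin 2) (Fin 2) ℂ}
    (hg : gᴴ * g = 1)
    (h : HasSchurFrame (tensorMatrix e ((g * coeffMatrix ψ) 0))
      (tensorMatrix e ((g * coeffMatrix ψ) 1)) y) :
    ∃ Y ∈ roofValues (gqPure q) (trRight e (proj ψ)),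
      Y ≤ gqPair q (∑ x, ‖(g * coeffMatrix ψ) 0 x‖ ^ 2) y := by
  obtain ⟨r, C, t, hC, ht, hty, hfr⟩ := h
  let Ψ : Fin 2 → Matrix β γ ℂ := fun i => tensorMatrix e fun x => ψ (i, x)
  let w : Fin r ⊕ γ → Fin 2 × β → ℂ := fun k x => (Ψ x.1 * C) x.2 k
  have hrow : ∀ i b k, (g * coeffMatrix (w k)) i b =
      (tensorMatrix e ((g * coeffMatrix ψ) i) * C) b k := by
    intro i b k
    simp only [Matrix.mul_apply, coeffMatrix, Matrix.of_apply, w, Ψ, tensorMatrix, Finset.sum_mul,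
      Finset.mul_sum]
    rw [Finset.sum_comm]
    simp only [mul_assoc]
  have hnorm : ∑ k, ∑ x, ‖w k x‖ ^ 2 = 1 := by
    rw [Finset.sum_comm, Fintype.sum_prod_type]
    have h1 : ∀ i, ∑ b, ∑ k, ‖w k (i, b)‖ ^ 2 = ∑ x, ‖ψ (i, x)‖ ^ 2 := fun i => by
      rw [← frobSq_tensorMatrix e, ← frobSq_mul_of_mul_conjTranspose _ hC]
      rfl
    simp only [h1]
    rw [← Fintype.sum_prod_type (f := fun x => ‖ψ x‖ ^ 2)]
    exact hψ
  have htr : ∑ k, proj (w k) = trRight e (proj ψ) := by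
    ext x z
    have h1 : (Ψ x.1 * C) * (Ψ z.1 * C)ᴴ = Ψ x.1 * (Ψ z.1)ᴴ := by
      rw [conjTranspose_mul, Matrix.mul_assoc, ← Matrix.mul_assoc C, hC, Matrix.one_mul]
    have h2 : ∑ k, (Ψ x.1 * C) x.2 k * star ((Ψ z.1 * C) z.2 k) =
        ∑ c, Ψ x.1 x.2 c * star (Ψ z.1 z.2 c) := congrFun (congrFun h1 x.2) z.2
    simp only [Matrix.sum_apply, proj, vecMulVec_apply, Pi.star_apply, trRight, Matrix.of_apply]
    exact h2
  obtain ⟨φ, hφ, hwφ, hmem⟩ := exists_normalized_ensemble (E := gqPure q) w hnorm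
  rw [htr] at hmem
  refine ⟨_, hmem, ?_⟩
  calc ∑ k, (∑ x, ‖w k x‖ ^ 2) * gqPure q (φ k)
      ≤ ∑ k, gqPair q (∑ b, ‖(g * coeffMatrix (w k)) 0 b‖ ^ 2) (t k) := by
        refine Finset.sum_le_sum fun k _ => ?_
        refine mul_gqPure_le hq1 hq2 (by positivity) (ht k) (hφ k) (hwφ k) hg
          (u := fun b => (g * coeffMatrix (w k)) 0 b) (v := fun b => (g * coeffMatrix (w k)) 1 b)
          (fun _ => rfl) (fun _ => rfl) ?_
        simp only [hrow]
        exact hfr k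
    _ ≤ gqPair q (∑ k, ∑ b, ‖(g * coeffMatrix (w k)) 0 b‖ ^ 2) (∑ k, t k) :=
        sum_gqPair_le hq1 (fun k => by positivity) ht
    _ = gqPair q (∑ x, ‖(g * coeffMatrix ψ) 0 x‖ ^ 2) (∑ k, t k) := by
        rw [← frobSq_tensorMatrix e, ← frobSq_mul_of_mul_conjTranspose _ hC, frobSq,
          Finset.sum_comm]
        simp only [hrow]
    _ ≤ _ := gqPair_mono_right hq1 (by positivity) (Finset.sum_nonneg fun k _ => ht k) hty

/-- Monogamy for tripartite pure states, on the level of attained values of the roofs. -/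
lemma exists_roofValues_sq_add_le {q : ℝ} (hq1 : 1 ≤ q) (hq2 : q ≤ 2)
    (e : δ ≃ β × γ) {ψ : Fin 2 × δ → ℂ} (hψ : IsUnitVec ψ) :
    ∃ Y ∈ roofValues (gqPure q) (trRight e (proj ψ)),
      ∃ Z ∈ roofValues (gqPure q) (trRight (e.trans (Equiv.prodComm β γ)) (proj ψ)),
        Y ^ 2 + Z ^ 2 ≤ gqPure q ψ ^ 2 := by
  classical
  obtain ⟨g, hg, hle, hgq⟩ := exists_schmidt_basis q hψ
  obtain ⟨y₁, y₂, h1, h2, h12, hf1, hf2⟩ := exists_hasSchurFrame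
    (tensorMatrix e ((g * coeffMatrix ψ) 0)) (tensorMatrix e ((g * coeffMatrix ψ) 1))
  rw [frobSq_tensorMatrix] at h12
  obtain ⟨Y, hY, hYle⟩ := exists_roofValue_le hq1 hq2 e hψ hg hf1
  obtain ⟨Z, hZ, hZle⟩ := exists_roofValue_le hq1 hq2 (e.trans (Equiv.prodComm β γ)) hψ hg hf2
  refine ⟨Y, hY, Z, hZ, ?_⟩
  rw [hgq]
  refine le_trans ?_ (gqPair_sq_add_le hq1 hq2 hle h1 h2 h12)
  have hY0 := roofValues_gqPure_nonneg hq1 hY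
  have hZ0 := roofValues_gqPure_nonneg hq1 hZ
  gcongr

lemma sqrt_sum_sq_add_sum_sq_le {κ : Type*} [Fintype κ] {p x y : κ → ℝ} (hp : ∀ k, 0 ≤ p k) :
    √((∑ k, p k * x k) ^ 2 + (∑ k, p k * y k) ^ 2) ≤ ∑ k, p k * √(x k ^ 2 + y k ^ 2) := by
  have h : ∀ a b : ℝ, √(a ^ 2 + b ^ 2) = ‖(⟨a, b⟩ : ℂ)‖ := fun a b => by
    rw [Complex.norm_def, Complex.normSq_apply, ← sq, ← sq]
  simp only [h]
  have h1 : (⟨∑ k, p k * x k, ∑ k, p k * y k⟩ : ℂ) = ∑ k, (p k : ℂ) * ⟨x k, y k⟩ := by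
    apply Complex.ext <;> simp [Complex.re_sum, Complex.im_sum]
  rw [h1]
  refine (norm_sum_le _ _).trans (Finset.sum_le_sum fun k _ => ?_)
  rw [norm_mul, Complex.norm_real, Real.norm_eq_abs, abs_of_nonneg (hp k)]

/-- Monogamy for tripartite states. -/
lemma gqConcurrence_sq_add_le {q : ℝ} (hq1 : 1 ≤ q) (hq2 : q ≤ 2) (e : δ ≃ β × γ)
    {ρ : Matrix (Fin 2 × δ) (Fin 2 × δ) ℂ} (hρ : (roofValues (gqPure q) ρ).Nonempty) :
    gqConcurrence q (trRight e ρ) ^ 2 +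
        gqConcurrence q (trRight (e.trans (Equiv.prodComm β γ)) ρ) ^ 2 ≤
      gqConcurrence q ρ ^ 2 := by
  set S := gqConcurrence q (trRight e ρ) ^ 2 +
        gqConcurrence q (trRight (e.trans (Equiv.prodComm β γ)) ρ) ^ 2 with hS
  have hS0 : 0 ≤ S := by positivity
  suffices h : √S ≤ gqConcurrence q ρ by
    have := pow_le_pow_left₀ (Real.sqrt_nonneg _) h 2
    rwa [Real.sq_sqrt hS0] at this
  refine le_csInf hρ ?_
  rintro _ ⟨m, p, ψ, hdec, rfl⟩
  choose Y hY Z hZ hYZ using fun i => exists_roofValues_sq_add_le hq1 hq2 e (hdec.unit i)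
  have h1 := gqConcurrence_le hq1 (sum_mem_roofValues hdec.nonneg hdec.sum_eq_one hY)
  have h2 := gqConcurrence_le hq1 (sum_mem_roofValues hdec.nonneg hdec.sum_eq_one hZ)
  rw [← trRight_sum_smul, ← hdec.sum_eq] at h1 h2
  calc √S ≤ √((∑ i, p i * Y i) ^ 2 + (∑ i, p i * Z i) ^ 2) := by
        apply Real.sqrt_le_sqrt
        have := gqConcurrence_nonneg hq1 (trRight e ρ)
        have := gqConcurrence_nonneg hq1 (trRight (e.trans (Equiv.prodComm β γ)) ρ)
        rw [hS]
        gcongr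
    _ ≤ ∑ i, p i * √(Y i ^ 2 + Z i ^ 2) := sqrt_sum_sq_add_sum_sq_le hdec.nonneg
    _ ≤ ∑ i, p i * gqPure q (ψ i) := by
        refine Finset.sum_le_sum fun i _ => mul_le_mul_of_nonneg_left ?_ (hdec.nonneg i)
        exact Real.sqrt_le_iff.2 ⟨gqPure_nonneg hq1 (hdec.unit i), hYZ i⟩

lemma roofValues_trRight_nonempty {q : ℝ} (hq1 : 1 ≤ q) (hq2 : q ≤ 2) (e : δ ≃ β × γ)
    {ρ : Matrix (Fin 2 × δ) (Fin 2 × δ) ℂ} (hρ : (roofValues (gqPure q) ρ).Nonempty) :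
    (roofValues (gqPure q) (trRight e ρ)).Nonempty := by
  obtain ⟨_, m, p, ψ, hdec, rfl⟩ := hρ
  choose Y hY Z hZ hYZ using fun i => exists_roofValues_sq_add_le hq1 hq2 e (hdec.unit i)
  have h := sum_mem_roofValues hdec.nonneg hdec.sum_eq_one hY
  rw [← trRight_sum_smul, ← hdec.sum_eq] at h
  exact ⟨_, h⟩

end Tripartite

/-! ### Many parties -/

section Parties
variable {n : ℕ} {d : Fin (n + 1) → ℕ}

/-- The first of the parties `A₂, …, A_N` split off from the others. -/
def restEquiv (d : Fin (n + 1) → ℕ) : Rest d ≃ Fin (d 0) × Rest fun j => d j.succ :=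
  (Fin.consEquiv fun j => Fin (d j)).symm

lemma pairState_zero (ρ : Matrix (Sys d) (Sys d) ℂ) :
    pairState ρ 0 = trRight (restEquiv d) ρ := by
  ext x y
  simp only [pairState, trRight, Matrix.of_apply]
  rw [Finset.sum_filter, ← (restEquiv d).symm.sum_comp, Fintype.sum_prod_type,
    Finset.sum_eq_single x.2]
  · refine Finset.sum_congr rfl fun f _ => ?_
    simp [restEquiv, Fin.consEquiv]
  · intro b _ hb
    refine Finset.sum_eq_zero fun f _ => ?_
    simp [restEquiv, Fin.consEquiv, hb]
  · simp

lemma pairState_succ (ρ : Matrix (Sys d) (Sys d) ℂ) (j : Fin n) :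
    pairState ρ j.succ =
      pairState (trRight ((restEquiv d).trans (Equiv.prodComm _ _)) ρ) j := by
  ext x y
  simp only [pairState, trRight, Matrix.of_apply]
  rw [Finset.sum_filter, Finset.sum_filter, ← (restEquiv d).symm.sum_comp,
    Fintype.sum_prod_type_right]
  refine Finset.sum_congr rfl fun f _ => ?_
  have h : ∀ b, (restEquiv d).symm (b, f) j.succ = f j := fun b => rfl
  simp only [h]
  split_ifs with hf
  · refine Finset.sum_congr rfl fun b _ => ?_
    congr 2
    simp [restEquiv, Fin.consEquiv]
  · simp

end Parties

/-- The squared `G_q`-concurrence is monogamous on every state of a qubit and finitely many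
parties of arbitrary dimensions. -/
lemma sGqCMonogamous_of_nonempty {q : ℝ} (hq1 : 1 ≤ q) (hq2 : q ≤ 2) {n : ℕ} {d : Fin n → ℕ}
    {ρ : Matrix (Sys d) (Sys d) ℂ} (hρ : (roofValues (gqPure q) ρ).Nonempty) :
    SGqCMonogamous q ρ := by
  induction n with
  | zero => simpa [SGqCMonogamous] using sq_nonneg _
  | succ n ih =>
    have h := gqConcurrence_sq_add_le hq1 hq2 (restEquiv d) hρ
    have h' := ih (roofValues_trRight_nonempty hq1 hq2
      ((restEquiv d).trans (Equiv.prodComm _ _)) hρ)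
    unfold SGqCMonogamous at h' ⊢
    rw [Fin.sum_univ_succ, pairState_zero]
    simp only [pairState_succ]
    linarith

lemma IsUnitVec.roofValues_proj_nonempty {ι : Type*} [Fintype ι] {E : (ι → ℂ) → ℝ} {ψ : ι → ℂ}
    (hψ : IsUnitVec ψ) : (roofValues E (proj ψ)).Nonempty := by
  have h := sum_mem_roofValues_of_decomposition (E := E) (κ := Unit) (p := fun _ => 1)
    (φ := fun _ => ψ) (fun _ => zero_le_one) (by simp) fun _ => hψ
  simp only [Finset.univ_unique, Finset.sum_singleton, Complex.ofReal_one, one_smul] at h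
  exact ⟨_, h⟩

end Entanglement

end

theorem theorem4 (n : ℕ) (d : Fin n → ℕ) (q : ℝ) (hq1 : 1 < q) (hq2 : q ≤ 2) :
    -- any state, pure or mixed: monogamy of SC implies monogamy of SG_qC
    (∀ ρ : Matrix (Entanglement.Sys d) (Entanglement.Sys d) ℂ, Entanglement.IsState ρ →
      Entanglement.SCMonogamous ρ → Entanglement.SGqCMonogamous q ρ) ∧
    -- monogamy of SC on the pure states of the system implies monogamy of SG_qC on all states
    ((∀ ψ : Entanglement.Sys d → ℂ, Entanglement.IsUnitVec ψ →
        Entanglement.SCMonogamous (Entanglement.proj ψ)) →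
      ∀ ρ : Matrix (Entanglement.Sys d) (Entanglement.Sys d) ℂ, Entanglement.IsState ρ →
        Entanglement.SGqCMonogamous q ρ) ∧
    -- a condition for monogamy of SG_qC that does not require monogamy of SC
    (∀ ψ : Entanglement.Sys d → ℂ, Entanglement.IsUnitVec ψ →
      ∑ j, Entanglement.hq q
          (Entanglement.concurrence (Entanglement.pairState (Entanglement.proj ψ) j) ^ 2) ^ 2 ≤
        Entanglement.hq q (Entanglement.concurrence (Entanglement.proj ψ) ^ 2) ^ 2 →
      Entanglement.SGqCMonogamous q (Entanglement.proj ψ)) ∧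
    -- monogamy of SG_qC on the pure states of the system implies it on all states
    ((∀ ψ : Entanglement.Sys d → ℂ, Entanglement.IsUnitVec ψ →
        Entanglement.SGqCMonogamous q (Entanglement.proj ψ)) →
      ∀ ρ : Matrix (Entanglement.Sys d) (Entanglement.Sys d) ℂ, Entanglement.IsState ρ →
        Entanglement.SGqCMonogamous q ρ) := by
  have main : ∀ ρ : Matrix (Entanglement.Sys d) (Entanglement.Sys d) ℂ, Entanglement.IsState ρ →
      Entanglement.SGqCMonogamous q ρ := fun ρ hρ =>
    Entanglement.sGqCMonogamous_of_nonempty hq1.le hq2 hρ.roofValues_nonempty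
  exact ⟨fun ρ hρ _ => main ρ hρ, fun _ => main,
    fun ψ hψ _ => Entanglement.sGqCMonogamous_of_nonempty hq1.le hq2 hψ.roofValues_proj_nonempty,
    fun _ => main⟩
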